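/- Let $G$ be a compact Lie group and let $\tau$ be a nontrivial (continuous, finite-dimensional, complex) irreducible representation of $G$ whose character $\chi^\tau$ is real valued. Let $\alpha\in G$, $\alpha\neq 1$, be conjugate to $\alpha^{-1}$, put $a=1-\frac{\chi^{\tau}(\alpha)}{\dim\tau}$, and assume $a\neq 0$. For an irreducible representation $\phi$ of $G$ let $\chi^\phi$ be its character and $m_\phi(\tau^2)$ its multiplicity in $\tau\otimes\tau$. Let $W=\chi^\tau(g)$, where $g$ is distributed according to the normalized Haar measure of $G$. Then the numbers $\chi^\phi(\alpha)$ are real, only finitely many $m_\phi(\tau^2)$ are nonzero, the second sum below is nonnegative, and for all real $x_0$, $$\left|\mathbb P(W\le x_0)-\frac1{\sqrt{2\pi}}\int_{-\infty}^{x_0}e^{-x^2/2}\,dx\right|\le\sqrt{\sum_{\phi}{}^{*}\,m_\phi(\tau^2)^2\left[2-\frac1a\left(1-\frac{\chi^\phi(\alpha)}{\dim\phi}\right)\right]^2}+\left[\frac1\pi\sum_\phi m_\phi(\tau^2)^2\left(8-\frac6a\left(1-\frac{\chi^\phi(\alpha)}{\dim\phi}\right)\right)\right]^{1/4}.$$ Here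 the second sum is over all isomorphism classes of irreducible representations $\phi$ of $G$, and the first sum is over all nontrivial ones. -/

import Mathlib

open MeasureTheory Set
open scoped ContDiff

noncomputable section

namespace CompactLieCLT

/-- A representation of a topological group on a finite-dimensional complex vector space is
continuous if all its matrix coefficients are continuous functions on the group. -/
def IsContinuousRep {G V : Type*} [Group G] [TopologicalSpace G] [AddCommGroup V] [Module ℂ V]
    (ρ : Representation ℂ G V) : Prop :=
  ∀ (v : V) (l : Module.Dual ℂ V), Continuous fun g : G => l (ρ g v)

/-- A continuous irreducible complex representation of `G` on a standard space `ℂⁿ`; every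
finite-dimensional continuous irreducible representation is isomorphic to one of these. -/
structure Irrep (G : Type*) [Group G] [TopologicalSpace G] where
  /-- the dimension -/
  n : ℕ
  /-- the representation -/
  rep : Representation ℂ G (Fin n → ℂ)
  continuous_rep : IsContinuousRep rep
  irreducible_rep : rep.IsIrreducible

/-- Isomorphism of representations. -/
instance irrepSetoid (G : Type*) [Group G] [TopologicalSpace G] : Setoid (Irrep G) where
  r φ ψ := Nonempty (φ.rep.Equiv ψ.rep)
  iseqv :=
    { refl := fun φ => ⟨Representation.Equiv.refl φ.rep⟩
      symm := fun ⟨e⟩ => ⟨e.symm⟩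
      trans := fun ⟨e⟩ ⟨f⟩ => ⟨e.trans f⟩ }

/-- The isomorphism classes of irreducible representations of `G`. -/
def IrrepClass (G : Type*) [Group G] [TopologicalSpace G] : Type _ :=
  Quotient (irrepSetoid G)

namespace IrrepClass

variable {G : Type*} [Group G] [TopologicalSpace G]

/-- A representative of an isomorphism class. Everything defined from it below (dimension,
character, multiplicity, triviality) is invariant under isomorphism. -/
def out (φ : IrrepClass G) : Irrep G := Quotient.out φ

/-- `dim φ`. -/
def dim (φ : IrrepClass G) : ℕ := φ.out.n

/-- The character `χ^φ`. -/
def character (φ : IrrepClass G) (g : G) : ℂ := φ.out.rep.character g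

/-- `φ` is the trivial representation. -/
def IsTrivial (φ : IrrepClass G) : Prop := φ.out.rep.IsTrivial

/-- The multiplicity of `φ` in a finite-dimensional representation `σ`:
the dimension of the space of intertwining maps from `φ` to `σ`. -/
def mult (φ : IrrepClass G) {V : Type*} [AddCommGroup V] [Module ℂ V]
    (σ : Representation ℂ G V) : ℕ :=
  Module.finrank ℂ (Representation.IntertwiningMap φ.out.rep σ)

end IrrepClass

end CompactLieCLT

end

/-! The proof is Stein's method of exchangeable pairs. Let `g` and `h` be independent and Haar
distributed, `W = χ^τ(g)` and `W' = χ^τ(hαh⁻¹g)`. Since `α` is conjugate to `α⁻¹`, the pair `(W,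
W')` is exchangeable (`integral_conj_mul_exchange`). By Schur's lemma, averaging `χ^φ(hαh⁻¹g)` over
`h` multiplies `χ^φ(g)` by `c_φ = χ^φ(α)/dim φ` (`integral_character_conj_mul`). For `φ = τ` this
says `E[W' | g] = (1 - a) W`.

Expanding `W² = Σ m_φ χ^φ` gives `D(g) = E[(W' - W)² | g] = Σ m_φ (2a - (1 - c_φ)) χ^φ(g)`.
Orthogonality of characters then computes all moments needed: `E(W' - W)² = 2a`, whence `a > 0`;
`E(W' - W)⁴ = aT`, where `T` is the second sum, whence `T ≥ 0`; and `E(2 - D/a)²` is the starred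
sum, its trivial coefficient being `2 - 2a/a = 0`.

For a test function with Lipschitz constant `L` and values in `[0, 1]`, the Stein equation `f' - wf
= h - E h(Z)`, with `Z` standard normal, has a solution with `|f'| ≤ 2` and `f'` Lipschitz with
constant `2L` (`exists_stein_solution`). Exchangeability and Taylor expansion bound the error by
`√E(2 - D/a)² + L E|W' - W|³/(2a)`. Replacing the indicator of a half-line by a ramp of width `δ`,
so `L = 1/δ`, costs `δ/(2√(2π))`. Optimising `δ` and using `(E|W' - W|³)² ≤ 2a · aT` produce the
term `(T/π)^{1/4}`. -/

noncomputable section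

namespace CompactLieCLT

/-! ### Weak continuity and vector-valued averages -/

section WeaklyContinuous

variable {X U U₁ U₂ : Type*} [TopologicalSpace X] [AddCommGroup U] [Module ℂ U]
  [AddCommGroup U₁] [Module ℂ U₁] [AddCommGroup U₂] [Module ℂ U₂]

/-- A vector-valued map is weakly continuous if all linear functionals of it are continuous. -/
def WeaklyContinuous (F : X → U) : Prop :=
  ∀ l : Module.Dual ℂ U, Continuous fun x => l (F x)

theorem WeaklyContinuous.comp_continuous {Y : Type*} [TopologicalSpace Y] {F : X → U}
    (hF : WeaklyContinuous F) {p : Y → X} (hp : Continuous p) :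
    WeaklyContinuous fun y => F (p y) := fun l => (hF l).comp hp

theorem WeaklyContinuous.map₂ [FiniteDimensional ℂ U₁] {F₁ : X → U₁} {F₂ : X → U₂}
    (h₁ : WeaklyContinuous F₁) (h₂ : WeaklyContinuous F₂) (B : U₁ →ₗ[ℂ] U₂ →ₗ[ℂ] U) :
    WeaklyContinuous fun x => B (F₁ x) (F₂ x) := by
  intro l
  let b := Module.finBasis ℂ U₁
  have : (fun x => l (B (F₁ x) (F₂ x))) = fun x => ∑ i, b.coord i (F₁ x) * l (B (b i) (F₂ x)) := by
    ext x
    conv_lhs => rw [← b.sum_repr (F₁ x)]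
    simp only [map_sum, map_smul, LinearMap.sum_apply, LinearMap.smul_apply, smul_eq_mul,
      Module.Basis.coord_apply]
  rw [this]
  exact continuous_finsetSum _ fun i _ => (h₁ _).mul (h₂ (l ∘ₗ B (b i)))

theorem weaklyContinuous_linearMap [FiniteDimensional ℂ U₁] [FiniteDimensional ℂ U₂]
    {F : X → U₁ →ₗ[ℂ] U₂}
    (h : ∀ (v : U₁) (l : Module.Dual ℂ U₂), Continuous fun x => l (F x v)) :
    WeaklyContinuous F := by
  intro l
  let b := Module.finBasis ℂ U₁
  let c := Module.finBasis ℂ U₂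
  have : (fun x => l (F x)) = fun x => ∑ i, ∑ j, c.coord j (F x (b i)) *
      l ((b.coord i).smulRight (c j)) := by
    ext x
    have hx : F x = ∑ i, ∑ j, c.coord j (F x (b i)) • (b.coord i).smulRight (c j) := by
      refine b.ext fun k => ?_
      simp only [LinearMap.sum_apply, LinearMap.smul_apply, LinearMap.smulRight_apply,
        Module.Basis.coord_apply, Module.Basis.repr_self]
      rw [Finset.sum_eq_single k]
      · simp
      · intro i _ hi
        simp [Finsupp.single_eq_of_ne hi]
      · simp
    conv_lhs => rw [hx]
    simp
  rw [this]
  exact continuous_finsetSum _ fun i _ => continuous_finsetSum _ fun j _ =>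
    (h _ _).mul continuous_const

/-- Integration is done coordinatewise, so averages of operators and matrices need no choice of
norm. -/
theorem WeaklyContinuous.exists_integral [CompactSpace X] [MeasurableSpace X] [BorelSpace X]
    (μ : Measure X) [IsFiniteMeasure μ] [FiniteDimensional ℂ U] {F : X → U}
    (hF : WeaklyContinuous F) :
    ∃ m : U, ∀ l : Module.Dual ℂ U, l m = ∫ x, l (F x) ∂μ := by
  let b := Module.finBasis ℂ U
  refine ⟨∑ i, (∫ x, b.coord i (F x) ∂μ) • b i, fun l => ?_⟩
  have : (fun x => l (F x)) = fun x => ∑ i, b.coord i (F x) * l (b i) := by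
    ext x
    conv_lhs => rw [← b.sum_repr (F x)]
    simp only [map_sum, map_smul, smul_eq_mul, Module.Basis.coord_apply]
  rw [this, integral_finsetSum]
  · simp only [map_sum, map_smul, smul_eq_mul, integral_mul_const]
  · exact fun i _ => ((hF _).integrable_of_hasCompactSupport
      (HasCompactSupport.of_compactSpace _)).mul_const _

end WeaklyContinuous

/-! ### Constructions on continuous representations -/

section ContinuousRep

variable {G V W : Type*} [Group G] [TopologicalSpace G]
  [AddCommGroup V] [Module ℂ V] [AddCommGroup W] [Module ℂ W]
  {ρ : Representation ℂ G V} {σ : Representation ℂ G W}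

theorem IsContinuousRep.weaklyContinuous [FiniteDimensional ℂ V] (h : IsContinuousRep ρ) :
    WeaklyContinuous fun g => ρ g := weaklyContinuous_linearMap h

theorem isContinuousRep_of_weaklyContinuous (h : WeaklyContinuous fun g => ρ g) :
    IsContinuousRep ρ := fun v l => h (l ∘ₗ LinearMap.applyₗ v)

theorem IsContinuousRep.continuous_character [FiniteDimensional ℂ V] (h : IsContinuousRep ρ) :
    Continuous ρ.character := h.weaklyContinuous (LinearMap.trace ℂ V)

theorem IsContinuousRep.linHom [IsTopologicalGroup G] [FiniteDimensional ℂ V]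
    [FiniteDimensional ℂ W] (hρ : IsContinuousRep ρ) (hσ : IsContinuousRep σ) :
    IsContinuousRep (ρ.linHom σ) := by
  intro f l
  exact (hσ.weaklyContinuous.map₂ (hρ.weaklyContinuous.comp_continuous continuous_inv)
    ((LinearMap.llcomp ℂ V W W).compl₂ (LinearMap.llcomp ℂ V V W f))) l

theorem IsContinuousRep.tprod [FiniteDimensional ℂ V]
    [FiniteDimensional ℂ W] (hρ : IsContinuousRep ρ) (hσ : IsContinuousRep σ) :
    IsContinuousRep (ρ.tprod σ) :=
  isContinuousRep_of_weaklyContinuous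
    (hρ.weaklyContinuous.map₂ hσ.weaklyContinuous (TensorProduct.mapBilinear (RingHom.id ℂ) V W V W))

theorem IsContinuousRep.subrepresentation (hρ : IsContinuousRep ρ) (U : Submodule ℂ V)
    (hU : ∀ g, U ≤ U.comap (ρ g)) : IsContinuousRep (ρ.subrepresentation U hU) := by
  intro v l
  obtain ⟨l', hl'⟩ := l.exists_extend
  have : (fun g => l (ρ.subrepresentation U hU g v)) = fun g => l' (ρ g v) := by
    ext g
    rw [← hl']
    rfl
  rw [this]
  exact hρ _ _

theorem IsContinuousRep.quotient (hρ : IsContinuousRep ρ) (U : Submodule ℂ V)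
    (hU : ∀ g, U ≤ U.comap (ρ g)) : IsContinuousRep (ρ.quotient U hU) := by
  intro v l
  obtain ⟨v, rfl⟩ := U.mkQ_surjective v
  exact hρ v (l ∘ₗ U.mkQ)

theorem IsContinuousRep.of_equiv (e : ρ.Equiv σ) (hρ : IsContinuousRep ρ) :
    IsContinuousRep σ := by
  intro w l
  have : (fun g => l (σ g w)) = fun g => (l ∘ₗ e.toLinearMap) (ρ g (e.symm w)) := by
    ext g
    have := e.toIntertwiningMap.isIntertwining _ _ g (e.symm w)
    simp_all
  rw [this]
  exact hρ _ _

-- A merely linear splitting of `V → V/U` suffices, because cyclicity of the trace collects both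
-- terms into one trace; no invariant complement is needed.
omit [TopologicalSpace G] in
theorem character_eq_subrepresentation_add_quotient [FiniteDimensional ℂ V] (U : Submodule ℂ V)
    (hU : ∀ g, U ≤ U.comap (ρ g)) (g : G) :
    ρ.character g =
      (ρ.subrepresentation U hU).character g + (ρ.quotient U hU).character g := by
  obtain ⟨p, hp⟩ := U.subtype.exists_leftInverse_of_injective U.ker_subtype
  obtain ⟨s, hs⟩ := U.mkQ.exists_rightInverse_of_surjective U.range_mkQ
  -- The correction makes `p ∘ s' = 0`, so that `p` and `s'` belong to the same direct sum
  -- decomposition.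
  let s' := s - U.subtype ∘ₗ p ∘ₗ s
  have hs' : U.mkQ ∘ₗ s' = LinearMap.id := by
    simp only [s', LinearMap.comp_sub, hs, ← LinearMap.comp_assoc]
    ext
    simp
  have hid : U.subtype ∘ₗ p + s' ∘ₗ U.mkQ = LinearMap.id := by
    ext v
    have h1 : v - s (U.mkQ v) ∈ U := by
      rw [← Submodule.Quotient.mk_eq_zero, Submodule.Quotient.mk_sub, sub_eq_zero]
      exact (LinearMap.congr_fun hs (U.mkQ v)).symm
    have h2 := congrArg U.subtype (LinearMap.congr_fun hp ⟨_, h1⟩)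
    simp only [LinearMap.comp_apply, Submodule.subtype_apply, map_sub, LinearMap.id_apply] at h2
    simp only [s', LinearMap.add_apply, LinearMap.comp_apply, LinearMap.sub_apply,
      Submodule.subtype_apply, LinearMap.id_apply]
    rw [add_sub_left_comm, h2]
    abel
  have h1 : (ρ.subrepresentation U hU) g = p ∘ₗ (ρ g ∘ₗ U.subtype) := by
    ext v
    have := LinearMap.congr_fun hp ((ρ.subrepresentation U hU) g v)
    simpa using (congrArg Subtype.val this).symm
  have h2 : (ρ.quotient U hU) g = U.mkQ ∘ₗ (ρ g ∘ₗ s') := by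
    have : (ρ.quotient U hU) g ∘ₗ U.mkQ = U.mkQ ∘ₗ ρ g := rfl
    rw [← LinearMap.comp_assoc, ← this, LinearMap.comp_assoc, hs', LinearMap.comp_id]
  simp only [Representation.character]
  rw [h1, h2, ← LinearMap.trace_comp_comm' p, ← LinearMap.trace_comp_comm' U.mkQ, ← map_add,
    LinearMap.comp_assoc, LinearMap.comp_assoc, ← LinearMap.comp_add, hid, LinearMap.comp_id]

end ContinuousRep

/-! ### Unimodularity of compact groups -/

section Invariance

variable {G : Type*} [Group G] [TopologicalSpace G] [IsTopologicalGroup G] [CompactSpace G]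
  [MeasurableSpace G] [BorelSpace G]

theorem isMulRightInvariant_of_compactSpace (μ : Measure G) [μ.IsHaarMeasure]
    [IsProbabilityMeasure μ] : μ.IsMulRightInvariant := by
  refine ⟨fun g => ?_⟩
  have : IsProbabilityMeasure (Measure.map (· * g) μ) :=
    Measure.isProbabilityMeasure_map (by fun_prop)
  exact Measure.isHaarMeasure_eq_of_isProbabilityMeasure _ _

end Invariance

/-! ### Irreducibility through invariant subspaces -/

section Irreducible

variable {G V W : Type*} [Group G]
  [AddCommGroup V] [Module ℂ V] [AddCommGroup W] [Module ℂ W]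
  {ρ : Representation ℂ G V} {σ : Representation ℂ G W}

theorem isIrreducible_iff : ρ.IsIrreducible ↔ Nontrivial V ∧
    ∀ U : Submodule ℂ V, (∀ g, U ≤ U.comap (ρ g)) → U = ⊥ ∨ U = ⊤ := by
  constructor
  · intro h
    refine ⟨?_, fun U hU => ?_⟩
    · by_contra hV
      rw [not_nontrivial_iff_subsingleton] at hV
      obtain ⟨x, y, hxy⟩ := h.toNontrivial
      exact hxy (Subrepresentation.toSubmodule_injective (Subsingleton.elim _ _))
    · exact (h.eq_bot_or_eq_top ⟨U, fun g v hv => hU g hv⟩).imp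
        (congrArg Subrepresentation.toSubmodule) (congrArg Subrepresentation.toSubmodule)
  · rintro ⟨hV, h⟩
    have : Nontrivial (Subrepresentation ρ) := by
      refine ⟨⊥, ⊤, fun h => ?_⟩
      exact bot_ne_top (α := Submodule ℂ V) (congrArg Subrepresentation.toSubmodule h)
    refine ⟨fun U => ?_⟩
    exact (h U.toSubmodule fun g v hv => U.apply_mem_toSubmodule g hv).imp
      (fun h => Subrepresentation.toSubmodule_injective h)
      (fun h => Subrepresentation.toSubmodule_injective h)

theorem isIrreducible_of_equiv (e : ρ.Equiv σ) (h : ρ.IsIrreducible) : σ.IsIrreducible := by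
  rw [isIrreducible_iff] at h ⊢
  obtain ⟨hV, h⟩ := h
  obtain ⟨f, hf⟩ : ∃ f : V ≃ₗ[ℂ] W, ∀ g v, f (ρ g v) = σ g (f v) :=
    ⟨e.toLinearEquiv, fun g v => e.toIntertwiningMap.isIntertwining _ _ g v⟩
  refine ⟨f.symm.toEquiv.nontrivial, fun U hU => ?_⟩
  have key := h (U.comap f.toLinearMap) fun g v hv => by
    simpa [hf] using hU g hv
  rcases key with key | key
  · left
    rw [Submodule.eq_bot_iff] at key ⊢
    intro x hx
    simpa using key (f.symm x) (by simpa using hx)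
  · right
    rw [Submodule.eq_top_iff'] at key ⊢
    intro x
    simpa using key (f.symm x)

end Irreducible

/-! ### Orthogonality relations and Schur averaging -/

section Haar

variable {G V W : Type*} [Group G] [TopologicalSpace G] [IsTopologicalGroup G] [CompactSpace G]
  [MeasurableSpace G] [BorelSpace G] (μ : Measure G) [μ.IsHaarMeasure] [IsProbabilityMeasure μ]
  [AddCommGroup V] [Module ℂ V] [FiniteDimensional ℂ V]
  [AddCommGroup W] [Module ℂ W] [FiniteDimensional ℂ W]
  {ρ : Representation ℂ G V} {σ : Representation ℂ G W}

/-- The average of `ρ g` over the group is a projection onto the invariants, and the trace of a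
projection is its rank. -/
theorem integral_character (hρ : IsContinuousRep ρ) :
    ∫ g, ρ.character g ∂μ = Module.finrank ℂ ρ.invariants := by
  obtain ⟨P, hP⟩ := hρ.weaklyContinuous.exists_integral μ
  have hPv (v : V) (l : Module.Dual ℂ V) : l (P v) = ∫ g, l (ρ g v) ∂μ :=
    hP (l ∘ₗ LinearMap.applyₗ v)
  have hproj : LinearMap.IsProj ρ.invariants P := by
    constructor
    · intro v h
      rw [← sub_eq_zero, ← Module.forall_dual_apply_eq_zero_iff ℂ]
      intro l
      rw [map_sub, sub_eq_zero, hPv, ← integral_mul_left_eq_self _ h]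
      have := hPv v (l ∘ₗ ρ h)
      simpa using this
    · intro v hv
      rw [← sub_eq_zero, ← Module.forall_dual_apply_eq_zero_iff ℂ]
      intro l
      rw [map_sub, sub_eq_zero, hPv]
      have hv' : ∀ g, ρ g v = v := hv
      simp [hv']
  rw [← hproj.trace, hP (LinearMap.trace ℂ V)]
  rfl

theorem integral_character_inv_mul_character (hρ : IsContinuousRep ρ) (hσ : IsContinuousRep σ) :
    ∫ g, ρ.character g⁻¹ * σ.character g ∂μ = Module.finrank ℂ (ρ.IntertwiningMap σ) := by
  rw [← (Representation.invariantsEquivIntertwiningMap ρ σ).finrank_eq,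
    ← integral_character μ (hρ.linHom hσ)]
  simp only [Representation.char_linHom]

open scoped Classical in
theorem integral_character_inv_mul_character_irreducible (hρ : IsContinuousRep ρ)
    (hσ : IsContinuousRep σ) (hρi : ρ.IsIrreducible) (hσi : σ.IsIrreducible) :
    ∫ g, ρ.character g⁻¹ * σ.character g ∂μ = if Nonempty (ρ.Equiv σ) then 1 else 0 := by
  cases isEmpty_or_nonempty (ρ.Equiv σ) with
  | inl h =>
    rw [integral_character_inv_mul_character μ hρ hσ]
    have : ρ.IsIrreducible := hρi
    have : σ.IsIrreducible := hσi
    simp [Module.finrank_eq_zero_of_subsingleton, h]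
  | inr h =>
    obtain ⟨e⟩ := h
    rw [← Representation.char_iso e, integral_character_inv_mul_character μ hρ hρ]
    simp [show Nonempty (ρ.Equiv σ) from ⟨e⟩]

-- Weyl's averaging trick: the averaged form `M = ∫ A(x⁻¹)ᴴ A(x⁻¹)` is invariant and invertible, so
-- `A(g⁻¹)` is similar to `A(g)ᴴ` and their traces agree.
open scoped ComplexConjugate Matrix ComplexOrder in
include μ in
theorem character_inv (hρ : IsContinuousRep ρ) (g : G) :
    ρ.character g⁻¹ = conj (ρ.character g) := by
  let b := Module.finBasis ℂ V
  let A : G → Matrix _ _ ℂ := fun g => LinearMap.toMatrix b b (ρ g)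
  have hA1 : A 1 = 1 := by simp [A]
  have hAmul (x y : G) : A (x * y) = A x * A y := by simp [A, LinearMap.toMatrix_mul]
  have hAc (i j) : Continuous fun g => A g i j := by
    simpa [A, LinearMap.toMatrix_apply] using hρ (b j) (b.coord i)
  have hAcont : Continuous A := continuous_matrix hAc
  let N : G → Matrix _ _ ℂ := fun x => (A x⁻¹)ᴴ * A x⁻¹
  have hN : Continuous N := by
    have : Continuous fun x : G => A x⁻¹ := hAcont.comp continuous_inv
    exact this.matrix_conjTranspose.matrix_mul this
  have hNw : WeaklyContinuous N := fun l => l.continuous_of_finiteDimensional.comp hN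
  obtain ⟨M, hlin⟩ := hNw.exists_integral μ
  have hinv (h : G) : (A h)ᴴ * M * A h = M := by
    ext i j
    let l : Matrix (Fin (Module.finrank ℂ V)) (Fin (Module.finrank ℂ V)) ℂ →ₗ[ℂ] ℂ :=
      Matrix.entryLinearMap ℂ ℂ i j
    have h1 := hlin (l ∘ₗ LinearMap.mulRight ℂ (A h) ∘ₗ LinearMap.mulLeft ℂ (A h)ᴴ)
    have h2 := hlin l
    have h3 : ∀ x, (A h)ᴴ * N x * A h = N (h⁻¹ * x) := by
      intro x
      simp only [N, mul_inv_rev, inv_inv, hAmul, Matrix.conjTranspose_mul, Matrix.mul_assoc]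
    have h4 : l ((A h)ᴴ * M * A h) = ∫ x, l ((A h)ᴴ * N x * A h) ∂μ := h1
    simp only [h3] at h4
    rw [integral_mul_left_eq_self (fun x => l (N x)), ← h2] at h4
    exact h4
  -- If `M v = 0`, the continuous function `‖A(x⁻¹) v‖²` has integral zero. Haar measure charges
  -- open sets, so the function vanishes everywhere, in particular at `x = 1`.
  have hdet : IsUnit M := by
    rw [← Matrix.mulVec_injective_iff_isUnit]
    refine (injective_iff_map_eq_zero M.mulVecLin).2 fun v hv => ?_
    let q : G → ℝ := fun x => ∑ i, ‖(A x⁻¹ *ᵥ v) i‖ ^ 2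
    have hq : Continuous q := by
      have : Continuous fun x : G => A x⁻¹ *ᵥ v :=
        (hAcont.comp continuous_inv).matrix_mulVec continuous_const
      exact continuous_finsetSum _ fun i _ => ((continuous_apply i).comp this).norm.pow 2
    let l : Matrix (Fin (Module.finrank ℂ V)) (Fin (Module.finrank ℂ V)) ℂ →ₗ[ℂ] ℂ :=
      { toFun := fun B => star v ⬝ᵥ (B *ᵥ v)
        map_add' := fun B C => by rw [Matrix.add_mulVec, dotProduct_add]
        map_smul' := fun c B => by rw [Matrix.smul_mulVec, dotProduct_smul]; rfl }
    have hl (x : G) : l (N x) = (q x : ℂ) := by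
      change star v ⬝ᵥ (((A x⁻¹)ᴴ * A x⁻¹) *ᵥ v) = _
      rw [← Matrix.mulVec_mulVec, Matrix.dotProduct_mulVec, ← Matrix.star_mulVec]
      simp only [dotProduct, Pi.star_apply, q, Complex.ofReal_sum, Complex.ofReal_pow]
      exact Finset.sum_congr rfl fun i _ => Complex.conj_mul' _
    have h0 : ∫ x, q x ∂μ = 0 := by
      have h1 := hlin l
      have h2 : l M = 0 := by
        change star v ⬝ᵥ (M *ᵥ v) = 0
        rw [show M *ᵥ v = 0 from hv, dotProduct_zero]
      simp only [hl, h2, integral_complex_ofReal] at h1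
      exact_mod_cast h1.symm
    have hq0 : 0 ≤ q := fun x => Finset.sum_nonneg fun i _ => by positivity
    rw [integral_eq_zero_iff_of_nonneg hq0 (hq.integrable_of_hasCompactSupport
      (HasCompactSupport.of_compactSpace _)),
      Continuous.ae_eq_iff_eq μ hq continuous_zero] at h0
    have h1 : ∑ i, ‖v i‖ ^ 2 = 0 := by simpa [q, hA1] using congrFun h0 1
    rw [Finset.sum_eq_zero_iff_of_nonneg fun i _ => by positivity] at h1
    ext i
    simpa using h1 i (Finset.mem_univ i)
  have hMinv : M * M⁻¹ = 1 := Matrix.mul_nonsing_inv _ ((Matrix.isUnit_iff_isUnit_det _).1 hdet)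
  have hA' : A g * A g⁻¹ = 1 := by rw [← hAmul, mul_inv_cancel, hA1]
  have key : M * A g⁻¹ * M⁻¹ = (A g)ᴴ := by
    rw [← hinv g, Matrix.mul_assoc ((A g)ᴴ * M), hA', Matrix.mul_one, Matrix.mul_assoc, hinv g, hMinv,
      Matrix.mul_one]
  have htr (x : G) : ρ.character x = (A x).trace := by
    simp only [Representation.character, A]
    exact LinearMap.trace_eq_matrix_trace ℂ b (ρ x)
  rw [htr, htr, starRingEnd_apply, ← Matrix.trace_conjTranspose, ← key, Matrix.trace_mul_cycle,
    Matrix.nonsing_inv_mul _ ((Matrix.isUnit_iff_isUnit_det _).1 hdet), Matrix.one_mul]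

/-- The average `T` of `ρ(hαh⁻¹)` commutes with the representation, hence is a scalar by Schur's
lemma; its trace identifies the scalar as `χ(α)/dim`. -/
theorem integral_character_conj_mul (hρ : IsContinuousRep ρ) (hi : ρ.IsIrreducible) (α g : G) :
    ∫ h, ρ.character (h * α * h⁻¹ * g) ∂μ =
      ρ.character α / Module.finrank ℂ V * ρ.character g := by
  have hw : WeaklyContinuous fun h => ρ (h * α * h⁻¹) :=
    hρ.weaklyContinuous.comp_continuous (by fun_prop)
  obtain ⟨T, hT⟩ := hw.exists_integral μ
  have hcomm (x : G) : T ∘ₗ ρ x = ρ x ∘ₗ T := by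
    rw [← sub_eq_zero, ← Module.forall_dual_apply_eq_zero_iff ℂ]
    intro l
    rw [map_sub, sub_eq_zero]
    have h1 := hT (l ∘ₗ LinearMap.lcomp ℂ V (ρ x))
    have h2 := hT (l ∘ₗ LinearMap.llcomp ℂ V V V (ρ x))
    rw [← integral_mul_left_eq_self _ x] at h1
    calc l (T ∘ₗ ρ x) = _ := h1
      _ = _ := by
        refine integral_congr_ae (.of_forall fun h => ?_)
        change l (ρ _ * ρ x) = l (ρ x * ρ _)
        rw [← map_mul, ← map_mul]
        congr 2
        group
      _ = l (ρ x ∘ₗ T) := h2.symm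
  have : ρ.IsIrreducible := hi
  let f : ρ.IntertwiningMap ρ := ⟨T, hcomm⟩
  obtain ⟨c, hc⟩ :=
    (Representation.IsIrreducible.algebraMap_intertwiningMap_bijective_of_isAlgClosed
      (k := ℂ) (ρ := ρ)).2 f
  have hTc : T = c • LinearMap.id := by
    have := congrArg Representation.IntertwiningMap.toLinearMap hc
    rw [Representation.IntertwiningMap.algebraMap_apply] at this
    exact this.symm
  have htr := hT (LinearMap.trace ℂ V)
  have hα (h : G) : LinearMap.trace ℂ V (ρ (h * α * h⁻¹)) = ρ.character α :=
    ρ.char_conj α h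
  simp only [hα, hTc, map_smul, LinearMap.trace_id] at htr
  have hd : (Module.finrank ℂ V : ℂ) ≠ 0 := by
    have := (isIrreducible_iff.1 hi).1
    exact_mod_cast Module.finrank_pos.ne'
  have hg := hT (LinearMap.trace ℂ V ∘ₗ LinearMap.lcomp ℂ V (ρ g))
  calc ∫ h, ρ.character (h * α * h⁻¹ * g) ∂μ
      = ∫ h, (LinearMap.trace ℂ V ∘ₗ LinearMap.lcomp ℂ V (ρ g)) (ρ (h * α * h⁻¹)) ∂μ := by
        refine integral_congr_ae (.of_forall fun h => ?_)
        simp only [Representation.character, map_mul]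
        rfl
    _ = c * ρ.character g := by
        rw [← hg, hTc]
        simp only [LinearMap.comp_apply, map_smul, smul_eq_mul]
        rfl
    _ = _ := by
        congr 1
        rw [eq_div_iff hd]
        simpa using htr
end Haar

/-! ### Characters as sums of irreducible characters -/

section Decomposition

variable {G : Type*} [Group G] [TopologicalSpace G]

theorem exists_irrep_equiv {V : Type*} [AddCommGroup V] [Module ℂ V] [FiniteDimensional ℂ V]
    {σ : Representation ℂ G V} (hσ : IsContinuousRep σ) (hi : σ.IsIrreducible) :
    ∃ φ : Irrep G, Nonempty (σ.Equiv φ.rep) := by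
  let e : V ≃ₗ[ℂ] (Fin (Module.finrank ℂ V) → ℂ) := (Module.finBasis ℂ V).equivFun
  let ρ : Representation ℂ G (Fin (Module.finrank ℂ V) → ℂ) :=
    (e.conjRingEquiv : _ →* _).comp σ
  let E : σ.Equiv ρ := .mk e fun g => by
    ext v i
    simp [ρ, LinearEquiv.conjRingEquiv]
  exact ⟨⟨_, ρ, hσ.of_equiv E, isIrreducible_of_equiv E hi⟩, ⟨E⟩⟩

/-- Induction on the dimension. Characters are additive on a subrepresentation and its quotient, so
complete reducibility is not invoked. -/
theorem exists_multiset_character_eq {V : Type*} [AddCommGroup V] [Module ℂ V]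
    [FiniteDimensional ℂ V] {σ : Representation ℂ G V} (hσ : IsContinuousRep σ) :
    ∃ s : Multiset (Irrep G), ∀ g, σ.character g = (s.map fun φ => φ.rep.character g).sum := by
  induction hn : Module.finrank ℂ V using Nat.strong_induction_on generalizing V with
  | _ n ih =>
    subst hn
    by_cases hi : σ.IsIrreducible
    · obtain ⟨φ, ⟨e⟩⟩ := exists_irrep_equiv hσ hi
      exact ⟨{φ}, fun g => by simp [Representation.char_iso e]⟩
    rw [isIrreducible_iff, not_and] at hi
    rcases subsingleton_or_nontrivial V with hV | hV
    · refine ⟨0, fun g => ?_⟩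
      simp [Representation.character, Subsingleton.elim (σ g) 0]
    have := hi hV
    push Not at this
    obtain ⟨U, hU, hbot, htop⟩ := this
    have hsum := U.finrank_quotient_add_finrank
    have hpos : 0 < Module.finrank ℂ U := by
      have := Submodule.nontrivial_iff_ne_bot.2 hbot
      exact Module.finrank_pos
    obtain ⟨s, hs⟩ := ih _ (Submodule.finrank_lt htop) (hσ.subrepresentation U hU) rfl
    obtain ⟨t, ht⟩ := ih _ (by omega) (hσ.quotient U hU) rfl
    refine ⟨s + t, fun g => ?_⟩
    rw [character_eq_subrepresentation_add_quotient U hU, hs, ht, Multiset.map_add,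
      Multiset.sum_add]

end Decomposition

/-! ### Characters and multiplicities of isomorphism classes -/

namespace IrrepClass

variable {G : Type*} [Group G] [TopologicalSpace G]

theorem continuous_character (φ : IrrepClass G) : Continuous φ.character :=
  φ.out.continuous_rep.continuous_character

theorem dim_pos (φ : IrrepClass G) : 0 < φ.dim := by
  have := (isIrreducible_iff.1 φ.out.irreducible_rep).1
  by_contra h
  have h0 : φ.out.n = 0 := by simpa [dim] using h
  have : IsEmpty (Fin φ.out.n) := by rw [h0]; infer_instance
  exact not_subsingleton (Fin φ.out.n → ℂ) inferInstance

/-- The isomorphism class of an irreducible representation. -/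
def mk (φ : Irrep G) : IrrepClass G := Quotient.mk _ φ

theorem nonempty_equiv_out_mk (φ : Irrep G) : Nonempty ((mk φ).out.rep.Equiv φ.rep) :=
  Quotient.mk_out φ

theorem character_mk (φ : Irrep G) : (mk φ).character = φ.rep.character :=
  Representation.char_iso (nonempty_equiv_out_mk φ).some

theorem nonempty_equiv_iff {φ ψ : IrrepClass G} :
    Nonempty (φ.out.rep.Equiv ψ.out.rep) ↔ φ = ψ :=
  Quotient.out_equiv_out (s := irrepSetoid G)

variable [IsTopologicalGroup G] [CompactSpace G] [MeasurableSpace G] [BorelSpace G]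
  (μ : Measure G) [μ.IsHaarMeasure] [IsProbabilityMeasure μ]

open scoped Classical in
theorem integral_character_inv_mul_character (φ ψ : IrrepClass G) :
    ∫ g, φ.character g⁻¹ * ψ.character g ∂μ = if φ = ψ then 1 else 0 := by
  simp only [← nonempty_equiv_iff]
  exact integral_character_inv_mul_character_irreducible μ φ.out.continuous_rep
    ψ.out.continuous_rep φ.out.irreducible_rep ψ.out.irreducible_rep

include μ in
open scoped ComplexConjugate in
theorem character_inv (φ : IrrepClass G) (g : G) : φ.character g⁻¹ = conj (φ.character g) :=
  CompactLieCLT.character_inv μ φ.out.continuous_rep g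

theorem integral_character_conj_mul (φ : IrrepClass G) (α g : G) :
    ∫ h, φ.character (h * α * h⁻¹ * g) ∂μ = φ.character α / φ.dim * φ.character g := by
  have := CompactLieCLT.integral_character_conj_mul μ φ.out.continuous_rep φ.out.irreducible_rep α g
  rwa [Module.finrank_fin_fun] at this

variable {V : Type*} [AddCommGroup V] [Module ℂ V] [FiniteDimensional ℂ V]
  {σ : Representation ℂ G V}

-- Pairing the decomposition with `χ^φ` shows that the number of occurrences of `φ` is the dimension
-- of the space of intertwiners.
include μ in
theorem exists_finset_character_eq (hσ : IsContinuousRep σ) :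
    ∃ S : Finset (IrrepClass G), (∀ φ, φ.mult σ ≠ 0 → φ ∈ S) ∧
      ∀ g, σ.character g = ∑ φ ∈ S, (φ.mult σ : ℂ) * φ.character g := by
  classical
  obtain ⟨s, hs⟩ := exists_multiset_character_eq hσ
  let t : Multiset (IrrepClass G) := s.map mk
  have ht (g : G) : σ.character g = ∑ φ ∈ t.toFinset, (t.count φ : ℂ) * φ.character g := by
    rw [hs, show (s.map fun φ => φ.rep.character g) = t.map fun φ => φ.character g by
      simp only [t, Multiset.map_map, Function.comp_apply, character_mk],
      Finset.sum_multiset_map_count]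
    simp
  have hint {F : G → ℂ} (hF : Continuous F) : Integrable F μ :=
    hF.integrable_of_hasCompactSupport (HasCompactSupport.of_compactSpace _)
  have hm (φ : IrrepClass G) : φ.mult σ = t.count φ := by
    have h1 := CompactLieCLT.integral_character_inv_mul_character μ φ.out.continuous_rep hσ
    have h2 : ∫ g, φ.out.rep.character g⁻¹ * σ.character g ∂μ = t.count φ := by
      calc _ = ∫ g, ∑ ψ ∈ t.toFinset, (t.count ψ : ℂ) * (φ.character g⁻¹ * ψ.character g) ∂μ := by
            refine integral_congr_ae (.of_forall fun g => ?_)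
            simp only [ht, Finset.mul_sum]
            exact Finset.sum_congr rfl fun ψ _ => mul_left_comm _ _ _
        _ = ∑ ψ ∈ t.toFinset, (t.count ψ : ℂ) * if φ = ψ then 1 else 0 := by
            rw [integral_finsetSum]
            · simp only [integral_const_mul, integral_character_inv_mul_character]
            · intro ψ _
              exact hint (continuous_const.mul
                ((φ.continuous_character.comp continuous_inv).mul ψ.continuous_character))
        _ = t.count φ := by simp +contextual
    rw [h1] at h2
    exact_mod_cast h2
  refine ⟨t.toFinset, fun φ h => ?_, fun g => ?_⟩
  · rw [hm] at h
    simpa using h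
  · simp only [hm, ht]

end IrrepClass

/-! ### Normal density, tails and Mills ratio -/

section Gaussian

/-- The density of the standard normal distribution. -/
def gaussDensity (x : ℝ) : ℝ := (√(2 * Real.pi))⁻¹ * Real.exp (-x ^ 2 / 2)

/-- The distribution function of the standard normal distribution. -/
def gaussCDF (w : ℝ) : ℝ := ∫ z in Iic w, gaussDensity z

/-- The upper tail of the standard normal distribution. -/
def gaussTail (w : ℝ) : ℝ := ∫ z in Ioi w, gaussDensity z

theorem gaussDensity_pos (x : ℝ) : 0 < gaussDensity x := by
  unfold gaussDensity
  positivity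

theorem gaussDensity_le (x : ℝ) : gaussDensity x ≤ (√(2 * Real.pi))⁻¹ := by
  unfold gaussDensity
  refine mul_le_of_le_one_right (by positivity) (Real.exp_le_one_iff.2 ?_)
  nlinarith [sq_nonneg x]

theorem hasDerivAt_gaussDensity (x : ℝ) :
    HasDerivAt gaussDensity (-x * gaussDensity x) x := by
  have h := (((hasDerivAt_id x).pow 2).neg.div_const 2).exp.const_mul (√(2 * Real.pi))⁻¹
  refine h.congr_deriv ?_
  simp [gaussDensity]
  ring

theorem continuous_gaussDensity : Continuous gaussDensity := by
  unfold gaussDensity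
  fun_prop

theorem gaussDensity_eq (x : ℝ) :
    gaussDensity x = (√(2 * Real.pi))⁻¹ * Real.exp (-(1 / 2) * x ^ 2) := by
  rw [gaussDensity]
  congr 2
  ring

theorem gaussDensity_neg (x : ℝ) : gaussDensity (-x) = gaussDensity x := by
  simp [gaussDensity]

theorem integrable_gaussDensity : Integrable gaussDensity := by
  rw [funext gaussDensity_eq]
  exact (integrable_exp_neg_mul_sq (by norm_num)).const_mul _

theorem integrable_mul_gaussDensity : Integrable fun x => x * gaussDensity x := by
  simp only [gaussDensity_eq, mul_left_comm _ (√(2 * Real.pi))⁻¹]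
  exact (integrable_mul_exp_neg_mul_sq (b := 1 / 2) (by norm_num)).const_mul _

theorem integrable_sq_mul_gaussDensity : Integrable fun x => x ^ 2 * gaussDensity x := by
  simp only [gaussDensity_eq, mul_left_comm _ (√(2 * Real.pi))⁻¹]
  have := integrable_rpow_mul_exp_neg_mul_sq (b := 1 / 2) (by norm_num) (s := 2) (by norm_num)
  simp only [Real.rpow_two] at this
  exact this.const_mul _

theorem integral_gaussDensity : ∫ x, gaussDensity x = 1 := by
  simp only [gaussDensity_eq, integral_const_mul, integral_gaussian]
  rw [show Real.pi / (1 / 2) = 2 * Real.pi by ring]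
  exact inv_mul_cancel₀ (by positivity)

theorem integral_Ioi_deriv_eq {f f' : ℝ → ℝ} (h : ∀ x, HasDerivAt f (f' x) x)
    (hf : Integrable f) (hf' : Integrable f') (w : ℝ) : ∫ z in Ioi w, f' z = -f w := by
  rw [integral_Ioi_of_hasDerivAt_of_tendsto (h w).continuousAt.continuousWithinAt
    (fun x _ => h x) hf'.integrableOn
    (tendsto_zero_of_hasDerivAt_of_integrableOn_Ioi (a := w) (fun x _ => h x)
      hf'.integrableOn hf.integrableOn), zero_sub]

theorem integral_Iic_deriv_eq {f f' : ℝ → ℝ} (h : ∀ x, HasDerivAt f (f' x) x)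
    (hf : Integrable f) (hf' : Integrable f') (w : ℝ) : ∫ z in Iic w, f' z = f w := by
  rw [integral_Iic_of_hasDerivAt_of_tendsto (h w).continuousAt.continuousWithinAt
    (fun x _ => h x) hf'.integrableOn
    (tendsto_zero_of_hasDerivAt_of_integrableOn_Iic (a := w) (fun x _ => h x)
      hf'.integrableOn hf.integrableOn), sub_zero]

theorem integral_Ioi_mul_gaussDensity (w : ℝ) :
    ∫ z in Ioi w, z * gaussDensity z = gaussDensity w := by
  have := integral_Ioi_deriv_eq hasDerivAt_gaussDensity integrable_gaussDensity
    (by simp only [neg_mul]; exact integrable_mul_gaussDensity.neg) w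
  simp only [neg_mul, integral_neg] at this
  linarith

theorem integral_Iic_mul_gaussDensity (w : ℝ) :
    ∫ z in Iic w, z * gaussDensity z = -gaussDensity w := by
  have := integral_Iic_deriv_eq hasDerivAt_gaussDensity integrable_gaussDensity
    (by simp only [neg_mul]; exact integrable_mul_gaussDensity.neg) w
  simp only [neg_mul, integral_neg] at this
  linarith

theorem integral_Ioi_sq_mul_gaussDensity (w : ℝ) :
    ∫ z in Ioi w, z ^ 2 * gaussDensity z = w * gaussDensity w + gaussTail w := by
  have h (x : ℝ) : HasDerivAt (fun x => x * gaussDensity x)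
      (gaussDensity x - x ^ 2 * gaussDensity x) x := by
    refine ((hasDerivAt_id x).mul (hasDerivAt_gaussDensity x)).congr_deriv ?_
    simp only [id]
    ring
  have := integral_Ioi_deriv_eq h integrable_mul_gaussDensity
    (integrable_gaussDensity.sub integrable_sq_mul_gaussDensity) w
  rw [integral_sub integrable_gaussDensity.integrableOn
    integrable_sq_mul_gaussDensity.integrableOn] at this
  unfold gaussTail
  linarith

theorem gaussCDF_add_gaussTail (w : ℝ) : gaussCDF w + gaussTail w = 1 := by
  rw [← integral_gaussDensity]
  exact intervalIntegral.integral_Iic_add_Ioi integrable_gaussDensity.integrableOn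
    integrable_gaussDensity.integrableOn

theorem gaussCDF_eq_gaussTail_neg (w : ℝ) : gaussCDF w = gaussTail (-w) := by
  rw [gaussCDF, gaussTail, ← integral_comp_neg_Iic]
  simp only [gaussDensity_neg]

theorem gaussTail_nonneg (w : ℝ) : 0 ≤ gaussTail w :=
  integral_nonneg fun z => (gaussDensity_pos z).le

theorem integral_Ioi_sub_mul_gaussDensity (w : ℝ) :
    ∫ z in Ioi w, (z - w) * gaussDensity z = gaussDensity w - w * gaussTail w := by
  simp only [sub_mul]
  rw [integral_sub integrable_mul_gaussDensity.integrableOn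
    (integrable_gaussDensity.const_mul w).integrableOn, integral_const_mul,
    integral_Ioi_mul_gaussDensity, gaussTail]

theorem integral_Iic_sub_mul_gaussDensity (w : ℝ) :
    ∫ z in Iic w, (w - z) * gaussDensity z = w * gaussCDF w + gaussDensity w := by
  simp only [sub_mul]
  rw [integral_sub (integrable_gaussDensity.const_mul w).integrableOn
    integrable_mul_gaussDensity.integrableOn, integral_const_mul,
    integral_Iic_mul_gaussDensity, gaussCDF, sub_neg_eq_add]

theorem mul_gaussTail_le (w : ℝ) : w * gaussTail w ≤ gaussDensity w := by
  rw [← sub_nonneg, ← integral_Ioi_sub_mul_gaussDensity]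
  exact setIntegral_nonneg measurableSet_Ioi fun z hz =>
    mul_nonneg (sub_nonneg.2 (le_of_lt hz)) (gaussDensity_pos z).le

/-- The lower Mills ratio bound. -/
theorem mul_gaussDensity_le (w : ℝ) : w * gaussDensity w ≤ (1 + w ^ 2) * gaussTail w := by
  have hQ := gaussTail_nonneg w
  have hφ := gaussDensity_pos w
  rcases le_or_gt w 0 with hw | hw
  · nlinarith
  -- This approximates the mean of a normal variable conditioned to exceed `w`. Nonnegativity of the
  -- second moment about `s` on the tail gives slightly more than the claimed bound.
  let s : ℝ := w + 1 / w
  have h0 : 0 ≤ ∫ z in Ioi w, (z - s) ^ 2 * gaussDensity z :=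
    integral_nonneg fun z => mul_nonneg (sq_nonneg _) (gaussDensity_pos z).le
  have h1 : ∫ z in Ioi w, (z - s) ^ 2 * gaussDensity z =
      (w * gaussDensity w + gaussTail w) - 2 * s * gaussDensity w + s ^ 2 * gaussTail w := by
    have : ∀ z, (z - s) ^ 2 * gaussDensity z = z ^ 2 * gaussDensity z -
        2 * s * (z * gaussDensity z) + s ^ 2 * gaussDensity z := fun z => by ring
    simp only [this]
    rw [integral_add, integral_sub, integral_const_mul, integral_const_mul,
      integral_Ioi_mul_gaussDensity, integral_Ioi_sq_mul_gaussDensity, gaussTail]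
    · exact integrable_sq_mul_gaussDensity.integrableOn
    · exact (integrable_mul_gaussDensity.const_mul _).integrableOn
    · exact (integrable_sq_mul_gaussDensity.sub
        (integrable_mul_gaussDensity.const_mul _)).integrableOn
    · exact (integrable_gaussDensity.const_mul _).integrableOn
  rw [h1] at h0
  have h2 : 0 ≤ w ^ 2 * ((w * gaussDensity w + gaussTail w) - 2 * s * gaussDensity w +
      s ^ 2 * gaussTail w) := by positivity
  have h3 : w ^ 2 * ((w * gaussDensity w + gaussTail w) - 2 * s * gaussDensity w +
      s ^ 2 * gaussTail w) =
      (w ^ 4 + 3 * w ^ 2 + 1) * gaussTail w - (w ^ 3 + 2 * w) * gaussDensity w := by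
    simp only [s]
    field_simp
    ring
  rw [h3] at h2
  have h4 : (w ^ 4 + 3 * w ^ 2 + 1) * (w * gaussDensity w) ≤
      (w ^ 4 + 3 * w ^ 2 + 1) * ((1 + w ^ 2) * gaussTail w) := by
    nlinarith [mul_nonneg (by positivity : 0 ≤ 1 + w ^ 2) h2, mul_pos hw hφ]
  exact le_of_mul_le_mul_left h4 (by positivity)

theorem neg_mul_gaussDensity_le (w : ℝ) :
    -(w * gaussDensity w) ≤ (1 + w ^ 2) * gaussCDF w := by
  have := mul_gaussDensity_le (-w)
  rw [gaussDensity_neg, ← gaussCDF_eq_gaussTail_neg, neg_sq] at this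
  linarith

theorem neg_mul_gaussCDF_le (w : ℝ) : -(w * gaussCDF w) ≤ gaussDensity w := by
  have := mul_gaussTail_le (-w)
  rw [gaussDensity_neg, ← gaussCDF_eq_gaussTail_neg] at this
  linarith

end Gaussian

/-! ### The Stein equation for Lipschitz test functions -/

section SteinEquation

theorem hasDerivAt_integral_Iic {f : ℝ → ℝ} (hf : Continuous f) (hi : Integrable f) (w : ℝ) :
    HasDerivAt (fun x => ∫ z in Iic x, f z) (f w) w := by
  have h : (fun x => ∫ z in Iic x, f z) = fun x => (∫ z in Iic w, f z) + ∫ z in w..x, f z := by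
    ext x
    rw [← intervalIntegral.integral_Iic_sub_Iic hi.integrableOn hi.integrableOn]
    ring
  rw [h]
  exact ((hf.integral_hasStrictDerivAt w w).hasDerivAt).const_add _

/-- Second-order Taylor estimate along the segment from `x` to `y`. Only a Lipschitz derivative is
assumed, since Stein solutions for ramps have kinks in `f'`. -/
theorem abs_sub_sub_mul_le {f f' : ℝ → ℝ} {K : ℝ} (h : ∀ x, HasDerivAt f (f' x) x)
    (hK : ∀ x y, |f' y - f' x| ≤ K * |y - x|) (x y : ℝ) :
    |f y - f x - (y - x) * f' x| ≤ K / 2 * (y - x) ^ 2 := by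
  let u : ℝ → ℝ := fun s => f (x + s * (y - x)) - f x - s * ((y - x) * f' x)
  have hu (s : ℝ) : HasDerivAt u ((f' (x + s * (y - x)) - f' x) * (y - x)) s := by
    have h1 : HasDerivAt (fun s : ℝ => x + s * (y - x)) (y - x) s := by
      simpa using ((hasDerivAt_id s).mul_const (y - x)).const_add x
    have h2 : HasDerivAt (fun s : ℝ => s * ((y - x) * f' x)) ((y - x) * f' x) s := by
      simpa using (hasDerivAt_id s).mul_const ((y - x) * f' x)
    refine ((((h _).comp s h1).sub_const (f x)).sub h2).congr_deriv ?_
    ring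
  have hB (s : ℝ) : HasDerivAt (fun s => K / 2 * (y - x) ^ 2 * s ^ 2)
      (K * (y - x) ^ 2 * s) s := by
    refine ((hasDerivAt_pow 2 s).const_mul (K / 2 * (y - x) ^ 2)).congr_deriv ?_
    simp
    ring
  have := image_norm_le_of_norm_deriv_right_le_deriv_boundary (f := u) (a := 0) (b := 1)
    (fun s _ => (hu s).continuousAt.continuousWithinAt) (fun s _ => (hu s).hasDerivWithinAt)
    (B := fun s => K / 2 * (y - x) ^ 2 * s ^ 2) (by simp [u]) hB (fun s hs => by
      rw [norm_mul, Real.norm_eq_abs, Real.norm_eq_abs]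
      have h1 := hK x (x + s * (y - x))
      rw [add_sub_cancel_left, abs_mul, abs_of_nonneg hs.1] at h1
      calc _ ≤ K * (s * |y - x|) * |y - x| := by gcongr
        _ = K * |y - x| ^ 2 * s := by ring
        _ = _ := by rw [sq_abs]) (right_mem_Icc.2 zero_le_one)
  simpa [u] using this

/-- The solution of the Stein equation for a Lipschitz test function with values in `[0, 1]`,
with the bounds on its first two derivatives. -/
theorem exists_stein_solution {h : ℝ → ℝ} {L : ℝ} (h0 : ∀ x, 0 ≤ h x) (h1 : ∀ x, h x ≤ 1)
    (hL : ∀ x y, |h x - h y| ≤ L * |x - y|) :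
    ∃ f f' : ℝ → ℝ, (∀ w, HasDerivAt f (f' w) w) ∧
      (∀ w, f' w - w * f w = h w - ∫ z, h z * gaussDensity z) ∧ (∀ w, |f' w| ≤ 2) ∧
      ∀ x y, |f' y - f' x| ≤ 2 * L * |y - x| := by
  have hL0 : 0 ≤ L := by simpa using (abs_nonneg _).trans (hL 1 0)
  have hc : Continuous h :=
    (LipschitzWith.of_dist_le_mul (K := ⟨L, hL0⟩) fun x y => hL x y).continuous
  have hint : Integrable fun z => h z * gaussDensity z :=
    integrable_gaussDensity.bdd_mul (c := 1) hc.aestronglyMeasurable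
      (.of_forall fun x => by rw [Real.norm_eq_abs, abs_of_nonneg (h0 x)]; exact h1 x)
  set c := ∫ z, h z * gaussDensity z with hcdef
  have hc0 : 0 ≤ c := integral_nonneg fun z => mul_nonneg (h0 z) (gaussDensity_pos z).le
  have hc1 : c ≤ 1 := by
    rw [← integral_gaussDensity]
    exact integral_mono hint integrable_gaussDensity fun z =>
      mul_le_of_le_one_left (gaussDensity_pos z).le (h1 z)
  have hhc (w : ℝ) : |h w - c| ≤ 1 := abs_le.2 ⟨by linarith [h0 w], by linarith [h1 w]⟩
  have hintc : Integrable fun z => (h z - c) * gaussDensity z := by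
    simp only [sub_mul]
    exact hint.sub (integrable_gaussDensity.const_mul c)
  have hcontc : Continuous fun z => (h z - c) * gaussDensity z :=
    (hc.sub continuous_const).mul continuous_gaussDensity
  -- The Gaussian density is the integrating factor of the Stein equation, so its solution is `F`
  -- divided by the density.
  let F : ℝ → ℝ := fun w => ∫ z in Iic w, (h z - c) * gaussDensity z
  have hF (w : ℝ) : HasDerivAt F ((h w - c) * gaussDensity w) w :=
    hasDerivAt_integral_Iic hcontc hintc w
  let f : ℝ → ℝ := fun w => F w / gaussDensity w
  let f' : ℝ → ℝ := fun w => h w - c + w * f w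
  have hf (w : ℝ) : HasDerivAt f (f' w) w := by
    have hφ := (gaussDensity_pos w).ne'
    refine ((hF w).div (hasDerivAt_gaussDensity w) hφ).congr_deriv ?_
    simp only [f', f]
    field_simp
    ring
  -- The centred integrand has total mass zero; the upper tail is thus available for `w ≥ 0`, where
  -- it is the small one.
  have hFtail (w : ℝ) : F w = -∫ z in Ioi w, (h z - c) * gaussDensity z := by
    have h1 : F w + ∫ z in Ioi w, (h z - c) * gaussDensity z =
        ∫ z, (h z - c) * gaussDensity z :=
      intervalIntegral.integral_Iic_add_Ioi hintc.integrableOn hintc.integrableOn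
    have h2 : ∫ z, (h z - c) * gaussDensity z = 0 := by
      simp only [sub_mul]
      rw [integral_sub hint (integrable_gaussDensity.const_mul c), integral_const_mul,
        integral_gaussDensity, ← hcdef]
      ring
    linarith
  have hbd (s : Set ℝ) : |∫ z in s, (h z - c) * gaussDensity z| ≤ ∫ z in s, gaussDensity z := by
    refine norm_integral_le_of_norm_le (f := fun z => (h z - c) * gaussDensity z)
      integrable_gaussDensity.integrableOn (.of_forall fun z => ?_)
    rw [norm_mul, Real.norm_eq_abs, Real.norm_eq_abs, abs_of_pos (gaussDensity_pos z)]
    exact mul_le_of_le_one_left (gaussDensity_pos z).le (hhc z)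
  have hwf (w : ℝ) : |w * f w| ≤ 1 := by
    have hφ := gaussDensity_pos w
    simp only [f]
    rw [← mul_div_assoc, abs_div, abs_of_pos hφ, div_le_one hφ, abs_mul]
    rcases le_total 0 w with hw | hw
    · rw [abs_of_nonneg hw, hFtail, abs_neg]
      exact (mul_le_mul_of_nonneg_left (hbd _) hw).trans (mul_gaussTail_le w)
    · rw [abs_of_nonpos hw]
      exact (mul_le_mul_of_nonneg_left (hbd _) (neg_nonneg.2 hw)).trans
        (by simpa [gaussCDF] using neg_mul_gaussCDF_le w)
  have hg (w : ℝ) : HasDerivAt (fun w => w * f w) (f w + w * f' w) w := by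
    refine ((hasDerivAt_id w).mul (hf w)).congr_deriv ?_
    simp
  -- As `f' = h - c + w f`, the Lipschitz constant `2L` of `f'` is the sum of `L` from `h` and a
  -- bound `L` on the derivative of `w f`. Both `h w - c` and `F w` are written through the
  -- differences of `h` in `A` and `B`.
  have hgL (w : ℝ) : |f w + w * f' w| ≤ L := by
    have hφ := gaussDensity_pos w
    have hPQ := gaussCDF_add_gaussTail w
    set A := ∫ z in Iic w, (h z - h w) * gaussDensity z with hA
    set B := ∫ z in Ioi w, (h w - h z) * gaussDensity z with hB
    have hAle : |A| ≤ L * (w * gaussCDF w + gaussDensity w) := by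
      rw [← integral_Iic_sub_mul_gaussDensity, ← integral_const_mul]
      have hi : IntegrableOn (fun z => L * ((w - z) * gaussDensity z)) (Iic w) := by
        simp only [sub_mul]
        exact (((integrable_gaussDensity.const_mul w).sub
          integrable_mul_gaussDensity).const_mul L).integrableOn
      refine norm_integral_le_of_norm_le (f := fun z => (h z - h w) * gaussDensity z) hi
        ((ae_restrict_mem measurableSet_Iic).mono
        fun z hz => ?_)
      rw [norm_mul, Real.norm_eq_abs, Real.norm_eq_abs, abs_of_pos (gaussDensity_pos z),
        ← mul_assoc]
      refine mul_le_mul_of_nonneg_right ((hL _ _).trans_eq ?_) (gaussDensity_pos z).le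
      rw [abs_sub_comm, abs_of_nonneg (sub_nonneg.2 hz)]
    have hBle : |B| ≤ L * (gaussDensity w - w * gaussTail w) := by
      rw [← integral_Ioi_sub_mul_gaussDensity, ← integral_const_mul]
      have hi : IntegrableOn (fun z => L * ((z - w) * gaussDensity z)) (Ioi w) := by
        simp only [sub_mul]
        exact ((integrable_mul_gaussDensity.sub
          (integrable_gaussDensity.const_mul w)).const_mul L).integrableOn
      refine norm_integral_le_of_norm_le (f := fun z => (h w - h z) * gaussDensity z) hi
        ((ae_restrict_mem measurableSet_Ioi).mono
        fun z hz => ?_)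
      rw [norm_mul, Real.norm_eq_abs, Real.norm_eq_abs, abs_of_pos (gaussDensity_pos z),
        ← mul_assoc]
      refine mul_le_mul_of_nonneg_right ((hL _ _).trans_eq ?_) (gaussDensity_pos z).le
      rw [abs_sub_comm, abs_of_nonneg (sub_nonneg.2 (le_of_lt hz))]
    have hA' : A = (∫ z in Iic w, h z * gaussDensity z) - h w * gaussCDF w := by
      simp only [hA, sub_mul]
      rw [integral_sub hint.integrableOn (integrable_gaussDensity.const_mul _).integrableOn,
        integral_const_mul, gaussCDF]
    have hB' : B = h w * gaussTail w - ∫ z in Ioi w, h z * gaussDensity z := by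
      simp only [hB, sub_mul]
      rw [integral_sub (integrable_gaussDensity.const_mul _).integrableOn hint.integrableOn,
        integral_const_mul, gaussTail]
    have hcAB : (∫ z in Iic w, h z * gaussDensity z) + ∫ z in Ioi w, h z * gaussDensity z = c :=
      intervalIntegral.integral_Iic_add_Ioi hint.integrableOn hint.integrableOn
    have hFw : F w = (∫ z in Iic w, h z * gaussDensity z) - c * gaussCDF w := by
      simp only [F, sub_mul]
      rw [integral_sub hint.integrableOn (integrable_gaussDensity.const_mul _).integrableOn,
        integral_const_mul, gaussCDF]
    have hhw : h w - c = B - A := by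
      rw [hA', hB', ← hcAB]
      linear_combination (-h w) * hPQ
    have hFAB : F w = gaussTail w * A + gaussCDF w * B := by
      have : F w = A + (h w - c) * gaussCDF w := by rw [hFw, hA']; ring
      rw [this, hhw]
      linear_combination (-A) * hPQ
    have hfw : f w = (gaussTail w * A + gaussCDF w * B) / gaussDensity w := by
      simp only [f, hFAB]
    -- Both coefficients are nonnegative by the Mills bounds, and weighted by the bounds on `|A|`
    -- and `|B|` they add up to exactly `L`.
    have hdec : f w + w * f' w =
        ((1 + w ^ 2) * gaussTail w - w * gaussDensity w) / gaussDensity w * A +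
        ((1 + w ^ 2) * gaussCDF w + w * gaussDensity w) / gaussDensity w * B := by
      simp only [f', hhw, hfw]
      field_simp
      ring
    have ha := div_nonneg (sub_nonneg.2 (mul_gaussDensity_le w)) hφ.le
    have hb : 0 ≤ ((1 + w ^ 2) * gaussCDF w + w * gaussDensity w) / gaussDensity w :=
      div_nonneg (by linarith [neg_mul_gaussDensity_le w]) hφ.le
    rw [hdec]
    refine (abs_add_le _ _).trans ?_
    rw [abs_mul, abs_mul, abs_of_nonneg ha, abs_of_nonneg hb]
    refine (add_le_add (mul_le_mul_of_nonneg_left hAle ha)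
      (mul_le_mul_of_nonneg_left hBle hb)).trans_eq ?_
    have hQ : gaussTail w = 1 - gaussCDF w := by linarith
    rw [hQ]
    field_simp
    ring
  refine ⟨f, f', hf, fun w => by simp [f'], fun w => ?_, fun x y => ?_⟩
  · exact (abs_add_le _ _).trans (by linarith [hhc w, hwf w])
  · have h2 : |y * f y - x * f x| ≤ L * |y - x| :=
      Convex.norm_image_sub_le_of_norm_hasDerivWithin_le (s := univ)
        (fun w _ => (hg w).hasDerivWithinAt) (fun w _ => hgL w) convex_univ (mem_univ x)
        (mem_univ y)
    have h3 := hL y x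
    calc |f' y - f' x| = |(h y - h x) + (y * f y - x * f x)| := by
          congr 1; simp only [f']; ring
      _ ≤ _ := (abs_add_le _ _).trans (by linarith)

end SteinEquation

/-! ### Stein's method for exchangeable pairs -/

section SteinMethod

theorem sq_integral_mul_le {Ω : Type*} [MeasurableSpace Ω] {P : Measure Ω} {X Y : Ω → ℝ}
    (hX : Integrable (fun ξ => X ξ ^ 2) P) (hY : Integrable (fun ξ => Y ξ ^ 2) P)
    (hXY : Integrable (fun ξ => X ξ * Y ξ) P) :
    (∫ ξ, X ξ * Y ξ ∂P) ^ 2 ≤ (∫ ξ, X ξ ^ 2 ∂P) * ∫ ξ, Y ξ ^ 2 ∂P := by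
  have key (t : ℝ) : 0 ≤ (∫ ξ, X ξ ^ 2 ∂P) * (t * t) + (2 * ∫ ξ, X ξ * Y ξ ∂P) * t +
      ∫ ξ, Y ξ ^ 2 ∂P := by
    have h : 0 ≤ ∫ ξ, (X ξ * t + Y ξ) ^ 2 ∂P := integral_nonneg fun ξ => sq_nonneg _
    have he : ∀ ξ, (X ξ * t + Y ξ) ^ 2 = X ξ ^ 2 * (t * t) + X ξ * Y ξ * (2 * t) + Y ξ ^ 2 :=
      fun ξ => by ring
    have hi : Integrable (fun ξ => X ξ ^ 2 * (t * t) + X ξ * Y ξ * (2 * t)) P :=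
      (hX.mul_const _).add (hXY.mul_const _)
    simp only [he] at h
    rw [integral_add hi hY,
      integral_add (hX.mul_const _) (hXY.mul_const _), integral_mul_const,
      integral_mul_const] at h
    linarith
  have := discrim_le_zero key
  unfold discrim at this
  linarith

/-- The linear ramp that is `1` up to `t` and `0` from `t + δ` on. -/
def ramp (t δ x : ℝ) : ℝ := max 0 (min 1 (1 - (x - t) / δ))

theorem ramp_nonneg (t δ x : ℝ) : 0 ≤ ramp t δ x := le_max_left _ _

theorem ramp_le_one (t δ x : ℝ) : ramp t δ x ≤ 1 := max_le zero_le_one (min_le_left _ _)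

theorem ramp_of_le {t δ x : ℝ} (hδ : 0 < δ) (h : x ≤ t) : ramp t δ x = 1 := by
  have : (x - t) / δ ≤ 0 := div_nonpos_of_nonpos_of_nonneg (by linarith) hδ.le
  rw [ramp, min_eq_left (by linarith), max_eq_right zero_le_one]

theorem ramp_of_ge {t δ x : ℝ} (hδ : 0 < δ) (h : t + δ ≤ x) : ramp t δ x = 0 := by
  have : 1 ≤ (x - t) / δ := (one_le_div hδ).2 (by linarith)
  rw [ramp, max_eq_left ((min_le_right _ _).trans (by linarith))]

theorem ramp_of_mem {t δ x : ℝ} (hδ : 0 < δ) (h₁ : t ≤ x) (h₂ : x ≤ t + δ) :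
    ramp t δ x = 1 - (x - t) / δ := by
  have h3 : 0 ≤ (x - t) / δ := div_nonneg (by linarith) hδ.le
  have h4 : (x - t) / δ ≤ 1 := (div_le_one hδ).2 (by linarith)
  rw [ramp, min_eq_right (by linarith), max_eq_right (by linarith)]

theorem continuous_ramp (t δ : ℝ) : Continuous (ramp t δ) := by
  unfold ramp
  fun_prop

theorem abs_ramp_sub_le {δ : ℝ} (hδ : 0 < δ) (t x y : ℝ) :
    |ramp t δ x - ramp t δ y| ≤ 1 / δ * |x - y| := by
  unfold ramp
  rw [max_comm 0, max_comm 0, min_comm 1, min_comm 1]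
  refine (abs_max_sub_max_le_abs _ _ _).trans ((abs_inf_sub_inf_le_abs _ _ _).trans_eq ?_)
  rw [show 1 - (x - t) / δ - (1 - (y - t) / δ) = -(1 / δ * (x - y)) by ring, abs_neg, abs_mul,
    abs_of_pos (by positivity : 0 < 1 / δ)]

theorem integrable_ramp_mul_gaussDensity (t δ : ℝ) :
    Integrable fun z => ramp t δ z * gaussDensity z :=
  integrable_gaussDensity.bdd_mul (c := 1) (continuous_ramp t δ).aestronglyMeasurable
    (.of_forall fun x => by
      rw [Real.norm_eq_abs, abs_of_nonneg (ramp_nonneg t δ x)]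
      exact ramp_le_one t δ x)

theorem integral_ramp_eq {t δ : ℝ} (hδ : 0 < δ) :
    ∫ z, ramp t δ z * gaussDensity z =
      gaussCDF t + ∫ z in t..t + δ, (1 - (z - t) / δ) * gaussDensity z := by
  have hi := integrable_ramp_mul_gaussDensity t δ
  have h1 : ∫ z in Iic t, ramp t δ z * gaussDensity z = gaussCDF t :=
    setIntegral_congr_fun measurableSet_Iic fun z hz => by
      simp only [ramp_of_le hδ hz, one_mul]
  have h2 : ∫ z in Ioi (t + δ), ramp t δ z * gaussDensity z = 0 := by
    rw [setIntegral_congr_fun (g := fun _ => 0) measurableSet_Ioi fun z hz => by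
      simp only [ramp_of_ge hδ (le_of_lt hz), zero_mul]]
    simp
  have h3 : ∫ z in t..t + δ, ramp t δ z * gaussDensity z =
      ∫ z in t..t + δ, (1 - (z - t) / δ) * gaussDensity z := by
    refine intervalIntegral.integral_congr fun z hz => ?_
    rw [uIcc_of_le (by linarith)] at hz
    simp only [ramp_of_mem hδ hz.1 hz.2]
  have h4 := intervalIntegral.integral_Iic_sub_Iic hi.integrableOn hi.integrableOn
    (a := t) (b := t + δ)
  have h5 := intervalIntegral.integral_Iic_add_Ioi hi.integrableOn hi.integrableOn (b := t + δ)
  linarith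

/-- The ramp exceeds the indicator of `(-∞, t]` by a triangle of area `δ/2`, and the density is at
most `1/√(2π)`. -/
theorem integral_ramp_le {t δ : ℝ} (hδ : 0 < δ) :
    ∫ z, ramp t δ z * gaussDensity z ≤ gaussCDF t + (√(2 * Real.pi))⁻¹ * δ / 2 := by
  rw [integral_ramp_eq hδ]
  gcongr
  have hc := continuous_gaussDensity
  calc ∫ z in t..t + δ, (1 - (z - t) / δ) * gaussDensity z
      ≤ ∫ z in t..t + δ, (1 - (z - t) / δ) * (√(2 * Real.pi))⁻¹ := by
        refine intervalIntegral.integral_mono_on (by linarith)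
          (Continuous.intervalIntegrable (by fun_prop) _ _)
          (Continuous.intervalIntegrable (by fun_prop) _ _) fun z hz => ?_
        refine mul_le_mul_of_nonneg_left (gaussDensity_le z) ?_
        rw [sub_nonneg, div_le_one hδ]
        linarith [hz.2]
    _ = _ := by
        rw [intervalIntegral.integral_mul_const, intervalIntegral.integral_sub (by simp)
          (Continuous.intervalIntegrable (by fun_prop) _ _), intervalIntegral.integral_div,
          intervalIntegral.integral_sub (by simp) (by simp)]
        simp only [integral_id, intervalIntegral.integral_const]
        field_simp
        simp
        ring

theorem le_integral_ramp {t δ : ℝ} (hδ : 0 < δ) :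
    gaussCDF (t + δ) - (√(2 * Real.pi))⁻¹ * δ / 2 ≤ ∫ z, ramp t δ z * gaussDensity z := by
  have hc := continuous_gaussDensity
  have h := intervalIntegral.integral_Iic_sub_Iic integrable_gaussDensity.integrableOn
    integrable_gaussDensity.integrableOn (a := t) (b := t + δ)
  have h1 : ∫ z in t..t + δ, (1 - (z - t) / δ) * gaussDensity z =
      (∫ z in t..t + δ, gaussDensity z) - ∫ z in t..t + δ, (z - t) / δ * gaussDensity z := by
    rw [← intervalIntegral.integral_sub (Continuous.intervalIntegrable (by fun_prop) _ _)
      (Continuous.intervalIntegrable (by fun_prop) _ _)]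
    simp only [sub_mul, one_mul]
  have h2 : ∫ z in t..t + δ, (z - t) / δ * gaussDensity z ≤ (√(2 * Real.pi))⁻¹ * δ / 2 := by
    calc ∫ z in t..t + δ, (z - t) / δ * gaussDensity z
        ≤ ∫ z in t..t + δ, (z - t) / δ * (√(2 * Real.pi))⁻¹ := by
          refine intervalIntegral.integral_mono_on (by linarith)
            (Continuous.intervalIntegrable (by fun_prop) _ _)
            (Continuous.intervalIntegrable (by fun_prop) _ _) fun z hz => ?_
          exact mul_le_mul_of_nonneg_left (gaussDensity_le z)
            (div_nonneg (by linarith [hz.1]) hδ.le)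
      _ = _ := by
          rw [intervalIntegral.integral_mul_const, intervalIntegral.integral_div,
            intervalIntegral.integral_sub (by simp) (by simp)]
          simp only [integral_id, intervalIntegral.integral_const]
          field_simp
          simp
          ring
  rw [integral_ramp_eq hδ, h1]
  unfold gaussCDF at *
  linarith

/-- The minimum of `κδ/2 + A/(2δ)` is `√(κA)`, attained at `δ = √(A/κ)`; for `A = 0` it is only the
limit as `δ → 0`. -/
theorem le_add_sqrt_of_forall_pos {X S κ A : ℝ} (hκ : 0 < κ) (hA : 0 ≤ A)
    (h : ∀ δ, 0 < δ → X ≤ S + (κ * δ / 2 + A / (2 * δ))) : X ≤ S + √(κ * A) := by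
  rcases hA.eq_or_lt with rfl | hA
  · simp only [mul_zero, Real.sqrt_zero, add_zero]
    refine le_of_forall_pos_le_add fun ε hε => (h (2 * ε / κ) (by positivity)).trans_eq ?_
    field_simp
    ring
  · refine (h (√(κ * A) / κ) (by positivity)).trans_eq ?_
    have hs : √(κ * A) ^ 2 = κ * A := Real.sq_sqrt (by positivity)
    have : 0 < √(κ * A) := by positivity
    congr 1
    field_simp
    linear_combination -hs

variable {Ω : Type*} [MeasurableSpace Ω] {P : Measure Ω} [IsProbabilityMeasure P]
  {W W' D : Ω → ℝ} {a : ℝ}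

/-- Stein's method of exchangeable pairs, for a Lipschitz test function. -/
theorem abs_integral_sub_integral_gauss_le (ha : 0 < a)
    (hint : ∀ u : ℝ × ℝ → ℝ, Continuous u → Integrable (fun ξ => u (W ξ, W' ξ)) P)
    (hexch : ∀ u : ℝ × ℝ → ℝ, Continuous u → ∫ ξ, u (W ξ, W' ξ) ∂P = ∫ ξ, u (W' ξ, W ξ) ∂P)
    (hlin : ∀ u : ℝ → ℝ, Continuous u →
      ∫ ξ, u (W ξ) * (W' ξ - W ξ) ∂P = -a * ∫ ξ, u (W ξ) * W ξ ∂P)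
    (hD : Integrable D P) (hD2 : Integrable (fun ξ => D ξ ^ 2) P)
    (hcond : ∀ u : ℝ → ℝ, Continuous u →
      ∫ ξ, u (W ξ) * (W' ξ - W ξ) ^ 2 ∂P = ∫ ξ, u (W ξ) * D ξ ∂P)
    {h : ℝ → ℝ} {L : ℝ} (h0 : ∀ x, 0 ≤ h x) (h1 : ∀ x, h x ≤ 1)
    (hL : ∀ x y, |h x - h y| ≤ L * |x - y|) :
    |∫ ξ, h (W ξ) ∂P - ∫ z, h z * gaussDensity z| ≤
      √(∫ ξ, (2 - D ξ / a) ^ 2 ∂P) + L / (2 * a) * ∫ ξ, |W' ξ - W ξ| ^ 3 ∂P := by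
  obtain ⟨f, f', hf, hfh, hf2, hfL⟩ := exists_stein_solution h0 h1 hL
  have hL0 : 0 ≤ L := by simpa using (abs_nonneg _).trans (hL 1 0)
  have hfc : Continuous f := continuous_iff_continuousAt.2 fun x => (hf x).continuousAt
  have hf'c : Continuous f' :=
    (LipschitzWith.of_dist_le_mul (K := ⟨2 * L, by positivity⟩) fun x y => hfL y x).continuous
  have hhc : Continuous h :=
    (LipschitzWith.of_dist_le_mul (K := ⟨L, hL0⟩) fun x y => hL x y).continuous
  set c := ∫ z, h z * gaussDensity z
  have hI1 : Integrable (fun ξ => f' (W ξ)) P := hint (fun p => f' p.1) (by fun_prop)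
  have hI2 : Integrable (fun ξ => W ξ * f (W ξ)) P := hint (fun p => p.1 * f p.1) (by fun_prop)
  have hI3 : Integrable (fun ξ => f' (W ξ) * D ξ) P :=
    hD.bdd_mul (c := 2) hI1.aestronglyMeasurable (.of_forall fun ξ => hf2 _)
  have hI4 : Integrable (fun ξ => (W' ξ - W ξ) * (f (W' ξ) - f (W ξ))) P :=
    hint (fun p => (p.2 - p.1) * (f p.2 - f p.1)) (by fun_prop)
  have hI5 : Integrable (fun ξ => f' (W ξ) * (W' ξ - W ξ) ^ 2) P :=
    hint (fun p => f' p.1 * (p.2 - p.1) ^ 2) (by fun_prop)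
  have hI6 : Integrable (fun ξ => |W' ξ - W ξ| ^ 3) P :=
    hint (fun p => |p.2 - p.1| ^ 3) (by fun_prop)
  have hI7 : Integrable (fun ξ => f (W ξ) * (W' ξ - W ξ)) P :=
    hint (fun p => f p.1 * (p.2 - p.1)) (by fun_prop)
  have hst : ∫ ξ, h (W ξ) ∂P - c = ∫ ξ, f' (W ξ) ∂P - ∫ ξ, W ξ * f (W ξ) ∂P := by
    rw [← integral_sub hI1 hI2]
    simp only [hfh]
    rw [integral_sub (hint (fun p => h p.1) (by fun_prop)) (integrable_const c)]
    simp
  -- Swapping `W` and `W'` identifies the two halves of the product. With the regression property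
  -- this turns `E[W f(W)]` into an expectation of increments.
  have hanti : ∫ ξ, (W' ξ - W ξ) * (f (W' ξ) - f (W ξ)) ∂P =
      -2 * ∫ ξ, f (W ξ) * (W' ξ - W ξ) ∂P := by
    have e1 := hexch (fun p => f p.1 * (p.2 - p.1)) (by fun_prop)
    simp only at e1
    have e2 : ∀ ξ, (W' ξ - W ξ) * (f (W' ξ) - f (W ξ)) =
        -(f (W' ξ) * (W ξ - W' ξ)) - f (W ξ) * (W' ξ - W ξ) := fun ξ => by ring
    simp only [e2]
    rw [integral_sub _ hI7, integral_neg, ← e1]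
    · ring
    · exact (hint (fun p => f p.2 * (p.1 - p.2)) (by fun_prop)).neg
  have hWf : ∫ ξ, W ξ * f (W ξ) ∂P =
      1 / (2 * a) * ∫ ξ, (W' ξ - W ξ) * (f (W' ξ) - f (W ξ)) ∂P := by
    rw [hanti, hlin f hfc]
    simp only [mul_comm (W _)]
    field_simp
  have hrem : |∫ ξ, (W' ξ - W ξ) * (f (W' ξ) - f (W ξ)) ∂P - ∫ ξ, f' (W ξ) * D ξ ∂P| ≤
      L * ∫ ξ, |W' ξ - W ξ| ^ 3 ∂P := by
    rw [← hcond f' hf'c, ← integral_sub hI4 hI5, ← integral_const_mul]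
    refine norm_integral_le_of_norm_le (f := fun ξ => (W' ξ - W ξ) * (f (W' ξ) - f (W ξ)) -
      f' (W ξ) * (W' ξ - W ξ) ^ 2) (hI6.const_mul L) (.of_forall fun ξ => ?_)
    have := abs_sub_sub_mul_le hf hfL (W ξ) (W' ξ)
    rw [Real.norm_eq_abs, show (W' ξ - W ξ) * (f (W' ξ) - f (W ξ)) -
      f' (W ξ) * (W' ξ - W ξ) ^ 2 =
      (W' ξ - W ξ) * (f (W' ξ) - f (W ξ) - (W' ξ - W ξ) * f' (W ξ)) by ring, abs_mul]
    calc _ ≤ |W' ξ - W ξ| * (2 * L / 2 * (W' ξ - W ξ) ^ 2) := by gcongr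
      _ = _ := by rw [← sq_abs]; ring
  -- Cauchy–Schwarz for `2 - D/a` and `f'(W)/2`; the latter is at most one in absolute value because
  -- `|f'| ≤ 2`.
  have hmain : |∫ ξ, f' (W ξ) ∂P - 1 / (2 * a) * ∫ ξ, f' (W ξ) * D ξ ∂P| ≤
      √(∫ ξ, (2 - D ξ / a) ^ 2 ∂P) := by
    have hX : Integrable (fun ξ => 2 - D ξ / a) P := (integrable_const _).sub (hD.div_const a)
    have hX2 : Integrable (fun ξ => (2 - D ξ / a) ^ 2) P := by
      have : ∀ ξ, (2 - D ξ / a) ^ 2 = 4 - D ξ * (4 / a) + D ξ ^ 2 * (1 / a ^ 2) :=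
        fun ξ => by ring
      simp only [this]
      exact ((integrable_const _).sub (hD.mul_const _)).add (hD2.mul_const _)
    refine Real.abs_le_sqrt ?_
    have e1 : ∫ ξ, f' (W ξ) ∂P - 1 / (2 * a) * ∫ ξ, f' (W ξ) * D ξ ∂P =
        ∫ ξ, (2 - D ξ / a) * (f' (W ξ) / 2) ∂P := by
      rw [← integral_const_mul, ← integral_sub hI1 (hI3.const_mul _)]
      refine integral_congr_ae (.of_forall fun ξ => ?_)
      simp only
      field_simp
    rw [e1]
    have hle : ∀ x, (f' x / 2) ^ 2 ≤ 1 := fun x => by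
      rw [sq_le_one_iff_abs_le_one, abs_div, abs_two]
      linarith [hf2 x]
    have hY2 : Integrable (fun ξ => (f' (W ξ) / 2) ^ 2) P :=
      hint (fun p => (f' p.1 / 2) ^ 2) (by fun_prop)
    refine (sq_integral_mul_le hX2 hY2 ?_).trans ?_
    · exact hX.mul_bdd (c := 1) (hI1.div_const 2).aestronglyMeasurable (.of_forall fun ξ => by
        rw [Real.norm_eq_abs, ← sq_le_one_iff_abs_le_one]
        exact hle _)
    · refine mul_le_of_le_one_right (integral_nonneg fun ξ => sq_nonneg _) ?_
      exact (integral_mono hY2 (integrable_const 1) fun ξ => hle _).trans (by simp)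
  rw [hst, hWf]
  have ha2 : 0 < 1 / (2 * a) := by positivity
  calc _ = |(∫ ξ, f' (W ξ) ∂P - 1 / (2 * a) * ∫ ξ, f' (W ξ) * D ξ ∂P) -
        1 / (2 * a) * (∫ ξ, (W' ξ - W ξ) * (f (W' ξ) - f (W ξ)) ∂P -
          ∫ ξ, f' (W ξ) * D ξ ∂P)| := by congr 1; ring
    _ ≤ _ := by
      refine (abs_sub _ _).trans (add_le_add hmain ?_)
      rw [abs_mul, abs_of_pos ha2]
      refine (mul_le_mul_of_nonneg_left hrem ha2.le).trans_eq ?_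
      ring

/-- Stein's normal approximation bound for an exchangeable pair. -/
theorem abs_measureReal_sub_gaussCDF_le (ha : 0 < a)
    (hint : ∀ u : ℝ × ℝ → ℝ, Continuous u → Integrable (fun ξ => u (W ξ, W' ξ)) P)
    (hexch : ∀ u : ℝ × ℝ → ℝ, Continuous u → ∫ ξ, u (W ξ, W' ξ) ∂P = ∫ ξ, u (W' ξ, W ξ) ∂P)
    (hlin : ∀ u : ℝ → ℝ, Continuous u →
      ∫ ξ, u (W ξ) * (W' ξ - W ξ) ∂P = -a * ∫ ξ, u (W ξ) * W ξ ∂P)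
    (hD : Integrable D P) (hD2 : Integrable (fun ξ => D ξ ^ 2) P)
    (hcond : ∀ u : ℝ → ℝ, Continuous u →
      ∫ ξ, u (W ξ) * (W' ξ - W ξ) ^ 2 ∂P = ∫ ξ, u (W ξ) * D ξ ∂P)
    (hW : Measurable W) (x₀ : ℝ) :
    |P.real {ξ | W ξ ≤ x₀} - gaussCDF x₀| ≤ √(∫ ξ, (2 - D ξ / a) ^ 2 ∂P) +
      √((√(2 * Real.pi))⁻¹ * ((∫ ξ, |W' ξ - W ξ| ^ 3 ∂P) / a)) := by
  have hA : 0 ≤ (∫ ξ, |W' ξ - W ξ| ^ 3 ∂P) / a :=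
    div_nonneg (integral_nonneg fun ξ => by positivity) ha.le
  refine le_add_sqrt_of_forall_pos (by positivity) hA fun δ hδ => ?_
  have key (t : ℝ) := abs_integral_sub_integral_gauss_le ha hint hexch hlin hD hD2 hcond
    (ramp_nonneg t δ) (ramp_le_one t δ) (abs_ramp_sub_le hδ t)
  have hrint (t : ℝ) : Integrable (fun ξ => ramp t δ (W ξ)) P :=
    hint (fun p => ramp t δ p.1) ((continuous_ramp t δ).comp continuous_fst)
  have hms : MeasurableSet {ξ | W ξ ≤ x₀} := measurableSet_le hW measurable_const
  have hind : P.real {ξ | W ξ ≤ x₀} = ∫ ξ, {ξ | W ξ ≤ x₀}.indicator 1 ξ ∂P :=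
    (integral_indicator_one hms).symm
  have hindi : Integrable ({ξ | W ξ ≤ x₀}.indicator (1 : Ω → ℝ)) P :=
    (integrable_const 1).indicator hms
  -- The ramp that starts to fall at `x₀` lies above the indicator, and the one that reaches zero at
  -- `x₀` lies below it.
  have hup : P.real {ξ | W ξ ≤ x₀} ≤ ∫ ξ, ramp x₀ δ (W ξ) ∂P := by
    rw [hind]
    refine integral_mono hindi (hrint x₀) fun ξ => ?_
    by_cases hξ : W ξ ≤ x₀
    · simp [hξ, ramp_of_le hδ hξ]
    · simp [hξ, ramp_nonneg]
  have hlow : ∫ ξ, ramp (x₀ - δ) δ (W ξ) ∂P ≤ P.real {ξ | W ξ ≤ x₀} := by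
    rw [hind]
    refine integral_mono (hrint _) hindi fun ξ => ?_
    by_cases hξ : W ξ ≤ x₀
    · simp [hξ, ramp_le_one]
    · simp [hξ, ramp_of_ge hδ (by linarith : x₀ - δ + δ ≤ W ξ)]
  have e : 1 / δ / (2 * a) * ∫ ξ, |W' ξ - W ξ| ^ 3 ∂P =
      (∫ ξ, |W' ξ - W ξ| ^ 3 ∂P) / a / (2 * δ) := by
    field_simp
  simp only [e] at key
  have h1 := abs_le.1 (key x₀)
  have h2 := abs_le.1 (key (x₀ - δ))
  have h3 := integral_ramp_le hδ (t := x₀)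
  have h4 := le_integral_ramp hδ (t := x₀ - δ)
  rw [sub_add_cancel] at h4
  rw [abs_le]
  constructor <;> linarith [h1.1, h1.2, h2.1, h2.2]

end SteinMethod

/-! ### The trivial class and Parseval's identity -/

namespace IrrepClass

variable {G : Type*} [Group G] [TopologicalSpace G]

variable (G) in
/-- The trivial one-dimensional representation. -/
def trivIrrep : Irrep G where
  n := 1
  rep := Representation.trivial ℂ G (Fin 1 → ℂ)
  continuous_rep v l := by simpa using continuous_const
  irreducible_rep := isIrreducible_iff.2 ⟨inferInstance, fun U _ => by
    have : IsSimpleOrder (Submodule ℂ (Fin 1 → ℂ)) := by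
      rw [← isSimpleModule_iff, isSimpleModule_iff_finrank_eq_one]
      simp
    exact eq_bot_or_eq_top U⟩

variable (G) in
/-- The class of the trivial one-dimensional representation. -/
def triv : IrrepClass G := mk (trivIrrep G)

theorem character_triv (g : G) : (triv G).character g = 1 := by
  rw [triv, character_mk]
  exact (LinearMap.trace_id ℂ (Fin 1 → ℂ)).trans (by simp)

theorem character_one (φ : IrrepClass G) : φ.character 1 = φ.dim := by
  simp [character, dim]

theorem dim_triv : (triv G).dim = 1 := by
  have := character_one (triv G)
  rw [character_triv] at this
  exact_mod_cast this.symm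

theorem isTrivial_triv : (triv G).IsTrivial := by
  obtain ⟨e⟩ := nonempty_equiv_out_mk (trivIrrep G)
  refine ⟨fun g => LinearMap.ext fun v => e.toLinearEquiv.injective ?_⟩
  exact e.toIntertwiningMap.isIntertwining _ _ g v

variable [IsTopologicalGroup G] [CompactSpace G] [MeasurableSpace G] [BorelSpace G]
  (μ : Measure G) [μ.IsHaarMeasure] [IsProbabilityMeasure μ]

-- `IsTrivial` constrains only the action, not the dimension. A trivial irreducible class other than
-- `triv G` would have constant character `dim φ` orthogonal to `1`, forcing `dim φ = 0`.
include μ in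
theorem isTrivial_iff {φ : IrrepClass G} : φ.IsTrivial ↔ φ = triv G := by
  refine ⟨fun h => ?_, fun h => h ▸ isTrivial_triv⟩
  by_contra hne
  have h1 := integral_character_inv_mul_character μ φ (triv G)
  have h2 (g : G) : φ.character g = φ.dim := by
    rw [← character_one, character, character, Representation.character,
      Representation.character, h.out, map_one]
    rfl
  simp only [h2, character_triv, if_neg hne, mul_one, integral_const, probReal_univ,
    one_smul, Nat.cast_eq_zero] at h1
  exact φ.dim_pos.ne' h1

include μ in
theorem character_im_eq_zero (φ : IrrepClass G) {α : G} (hα : IsConj α α⁻¹) :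
    (φ.character α).im = 0 := by
  obtain ⟨k, hk⟩ := isConj_iff.1 hα
  have h : φ.character α⁻¹ = φ.character α := by
    rw [← hk]
    exact Representation.char_conj _ _ _
  rw [φ.character_inv μ] at h
  exact Complex.conj_eq_iff_im.1 h

open scoped ComplexConjugate in
/-- Parseval's identity for real-valued finite combinations of irreducible characters. -/
theorem integral_mul_eq_sum {S : Finset (IrrepClass G)} {r s : IrrepClass G → ℝ} {F F' : G → ℝ}
    (hF : ∀ g, (F g : ℂ) = ∑ φ ∈ S, (r φ : ℂ) * φ.character g)
    (hF' : ∀ g, (F' g : ℂ) = ∑ φ ∈ S, (s φ : ℂ) * φ.character g) :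
    ∫ g, F g * F' g ∂μ = ∑ φ ∈ S, r φ * s φ := by
  classical
  -- As `F` is real, it equals its conjugate, which puts the characters at `g⁻¹` as the
  -- orthogonality relations require.
  have hconj (g : G) : (F g : ℂ) = ∑ φ ∈ S, (r φ : ℂ) * φ.character g⁻¹ := by
    rw [← Complex.conj_ofReal (F g), hF, map_sum]
    refine Finset.sum_congr rfl fun φ _ => ?_
    rw [map_mul, Complex.conj_ofReal, φ.character_inv μ]
  have hi (φ ψ : IrrepClass G) :
      Integrable (fun g => (r φ * s ψ : ℂ) * (φ.character g⁻¹ * ψ.character g)) μ :=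
    Continuous.integrable_of_hasCompactSupport (continuous_const.mul
      ((φ.continuous_character.comp continuous_inv).mul ψ.continuous_character))
      (HasCompactSupport.of_compactSpace _)
  have : ((∫ g, F g * F' g ∂μ : ℝ) : ℂ) = ((∑ φ ∈ S, r φ * s φ : ℝ) : ℂ) := by
    rw [← integral_complex_ofReal]
    calc ∫ g, ((F g * F' g : ℝ) : ℂ) ∂μ
        = ∫ g, ∑ φ ∈ S, ∑ ψ ∈ S, (r φ * s ψ : ℂ) * (φ.character g⁻¹ * ψ.character g) ∂μ := by
          refine integral_congr_ae (.of_forall fun g => ?_)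
          simp only [Complex.ofReal_mul]
          rw [hconj, hF', Finset.sum_mul_sum]
          exact Finset.sum_congr rfl fun φ _ => Finset.sum_congr rfl fun ψ _ =>
            mul_mul_mul_comm _ _ _ _
      _ = ∑ φ ∈ S, ∑ ψ ∈ S, (r φ * s ψ : ℂ) * if φ = ψ then 1 else 0 := by
          rw [integral_finsetSum _ fun φ _ => integrable_finsetSum _ fun ψ _ => hi φ ψ]
          refine Finset.sum_congr rfl fun φ _ => ?_
          rw [integral_finsetSum _ fun ψ _ => hi φ ψ]
          simp only [integral_const_mul, integral_character_inv_mul_character]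
      _ = _ := by
          push_cast
          refine Finset.sum_congr rfl fun φ hφ => ?_
          simp [hφ]
  exact_mod_cast this

end IrrepClass

/-! ### Exchangeability from a random conjugate -/

section ExchangeablePair

variable {G : Type*} [Group G] [TopologicalSpace G] [IsTopologicalGroup G] [CompactSpace G]
  [SecondCountableTopology G] [MeasurableSpace G] [BorelSpace G]
  (μ : Measure G) [μ.IsHaarMeasure] [IsProbabilityMeasure μ]

omit [IsTopologicalGroup G] [IsProbabilityMeasure μ] in
theorem integrable_prod_of_continuous {F : G × G → ℝ} (hF : Continuous F) :
    Integrable F (μ.prod μ) :=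
  hF.integrable_of_hasCompactSupport (HasCompactSupport.of_compactSpace _)

/-- Multiplying a Haar distributed element by a uniform random conjugate of an element that is
conjugate to its inverse gives an exchangeable pair. -/
theorem integral_conj_mul_exchange {α : G} (hα : IsConj α α⁻¹) {F : G × G → ℝ}
    (hF : Continuous F) :
    ∫ p : G × G, F (p.1, p.2 * α * p.2⁻¹ * p.1) ∂μ.prod μ =
      ∫ p : G × G, F (p.2 * α * p.2⁻¹ * p.1, p.1) ∂μ.prod μ := by
  obtain ⟨k, hk⟩ := isConj_iff.1 hα
  have := isMulRightInvariant_of_compactSpace μ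
  have hi1 : Integrable (fun p : G × G => F (p.1, p.2 * α * p.2⁻¹ * p.1)) (μ.prod μ) :=
    integrable_prod_of_continuous μ (by fun_prop)
  have hi2 : Integrable (fun p : G × G => F (p.2 * α⁻¹ * p.2⁻¹ * p.1, p.1)) (μ.prod μ) :=
    integrable_prod_of_continuous μ (by fun_prop)
  have hi3 : Integrable (fun p : G × G => F (p.2 * α * p.2⁻¹ * p.1, p.1)) (μ.prod μ) :=
    integrable_prod_of_continuous μ (by fun_prop)
  calc ∫ p : G × G, F (p.1, p.2 * α * p.2⁻¹ * p.1) ∂μ.prod μ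
      = ∫ h, ∫ g, F (g, h * α * h⁻¹ * g) ∂μ ∂μ := integral_prod_symm _ hi1
    _ = ∫ h, ∫ g, F (h * α⁻¹ * h⁻¹ * g, g) ∂μ ∂μ := by
        refine integral_congr_ae (.of_forall fun h => ?_)
        simp only
        -- Left translation of `g` swaps the two arguments at the price of replacing `α` by `α⁻¹`.
        rw [← integral_mul_left_eq_self _ (h * α⁻¹ * h⁻¹)]
        refine integral_congr_ae (.of_forall fun g => ?_)
        simp only
        congr 2
        group
    _ = ∫ g, ∫ h, F (h * α⁻¹ * h⁻¹ * g, g) ∂μ ∂μ := by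
        rw [← integral_prod_symm _ hi2, integral_prod _ hi2]
    _ = ∫ g, ∫ h, F (h * α * h⁻¹ * g, g) ∂μ ∂μ := by
        refine integral_congr_ae (.of_forall fun g => ?_)
        simp only
        -- Right translation of `h` by the element conjugating `α` to `α⁻¹` restores `α`.
        rw [← integral_mul_right_eq_self (fun h => F (h * α * h⁻¹ * g, g)) k]
        refine integral_congr_ae (.of_forall fun h => ?_)
        simp only
        rw [← hk]
        congr 3
        group
    _ = _ := (integral_prod _ hi3).symm

end ExchangeablePair

/-! ### Conditional moments of a real character -/

section Character

variable {G V : Type*} [Group G] [TopologicalSpace G] [IsTopologicalGroup G] [CompactSpace G]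
  [MeasurableSpace G] [BorelSpace G]
  (μ : Measure G) [μ.IsHaarMeasure] [IsProbabilityMeasure μ]
  [AddCommGroup V] [Module ℂ V] [FiniteDimensional ℂ V] {τ : Representation ℂ G V}

omit [TopologicalSpace G] [IsTopologicalGroup G] [CompactSpace G] [MeasurableSpace G]
  [BorelSpace G] [FiniteDimensional ℂ V] in
theorem ofReal_re_character (hreal : ∀ g : G, (τ.character g).im = 0) (g : G) :
    ((τ.character g).re : ℂ) = τ.character g :=
  Complex.ext (by simp) (by simp [hreal g])

theorem integral_re_character_conj_mul (hτ : IsContinuousRep τ) (hirr : τ.IsIrreducible)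
    (hreal : ∀ g : G, (τ.character g).im = 0) (α g : G) :
    ∫ h, (τ.character (h * α * h⁻¹ * g)).re ∂μ =
      (τ.character α).re / Module.finrank ℂ V * (τ.character g).re := by
  have h := integral_character_conj_mul μ hτ hirr α g
  obtain ⟨w, hw⟩ : ∃ w : G → ℝ, ∀ x, τ.character x = w x :=
    ⟨_, fun x => (ofReal_re_character hreal x).symm⟩
  simp only [hw, integral_complex_ofReal] at h
  simp only [hw, Complex.ofReal_re]
  exact_mod_cast h

theorem integral_re_character_sq (hτ : IsContinuousRep τ) (hirr : τ.IsIrreducible)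
    (hreal : ∀ g : G, (τ.character g).im = 0) : ∫ g, (τ.character g).re ^ 2 ∂μ = 1 := by
  have h := integral_character_inv_mul_character_irreducible μ hτ hτ hirr hirr
  rw [if_pos ⟨.refl τ⟩] at h
  have hw (x : G) : τ.character x⁻¹ * τ.character x = (((τ.character x).re ^ 2 : ℝ) : ℂ) := by
    rw [character_inv μ hτ, Complex.conj_eq_iff_im.2 (hreal x), Complex.ofReal_pow,
      ofReal_re_character hreal, sq]
  simp only [hw, integral_complex_ofReal] at h
  exact_mod_cast h

/-- The square is the character of `τ ⊗ τ`, and averaging acts on each constituent by its own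
scalar. -/
theorem integral_re_character_sq_conj_mul
    (hreal : ∀ g : G, (τ.character g).im = 0) {α : G} (hα : IsConj α α⁻¹)
    {S : Finset (IrrepClass G)}
    (hS : ∀ g, ((τ.tprod τ).character g) = ∑ φ ∈ S, (φ.mult (τ.tprod τ) : ℂ) * φ.character g)
    (g : G) :
    ((∫ h, (τ.character (h * α * h⁻¹ * g)).re ^ 2 ∂μ : ℝ) : ℂ) =
      ∑ φ ∈ S, ((φ.mult (τ.tprod τ) * ((φ.character α).re / φ.dim) : ℝ) : ℂ) *
        φ.character g := by
  rw [← integral_complex_ofReal]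
  have h1 (x : G) : (((τ.character x).re ^ 2 : ℝ) : ℂ) = (τ.tprod τ).character x := by
    rw [Representation.char_tensor, Pi.mul_apply, Complex.ofReal_pow, ofReal_re_character hreal, sq]
  simp only [h1, hS]
  rw [integral_finsetSum]
  · refine Finset.sum_congr rfl fun φ _ => ?_
    rw [integral_const_mul, φ.integral_character_conj_mul μ]
    have : ((φ.character α).re : ℂ) = φ.character α :=
      Complex.ext (by simp) (by simp [φ.character_im_eq_zero μ hα])
    push_cast
    rw [this]
    ring
  · intro φ _
    refine Continuous.integrable_of_hasCompactSupport (continuous_const.mul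
      (φ.continuous_character.comp (by fun_prop))) (HasCompactSupport.of_compactSpace _)

end Character

/-! ### Moments of the pair and the normal approximation -/

section Moments

variable {G V : Type*} [Group G] [TopologicalSpace G] [IsTopologicalGroup G] [CompactSpace G]
  [SecondCountableTopology G] [MeasurableSpace G] [BorelSpace G]
  (μ : Measure G) [μ.IsHaarMeasure] [IsProbabilityMeasure μ]
  [AddCommGroup V] [Module ℂ V] [FiniteDimensional ℂ V] {τ : Representation ℂ G V}
  [DecidableEq (IrrepClass G)]

/-- Normal approximation of an irreducible real character, with the sums over a finite set of
classes that contains the trivial one and all constituents of `τ ⊗ τ`. -/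
theorem clt_of_finset (hτ : IsContinuousRep τ) (hirr : τ.IsIrreducible)
    (hreal : ∀ g : G, (τ.character g).im = 0) {α : G} (hα : IsConj α α⁻¹) {a : ℝ}
    (ha : a = 1 - (τ.character α).re / (Module.finrank ℂ V : ℝ)) (ha0 : a ≠ 0)
    {S : Finset (IrrepClass G)} (hSt : IrrepClass.triv G ∈ S)
    (hS : ∀ g, ((τ.tprod τ).character g) = ∑ φ ∈ S, (φ.mult (τ.tprod τ) : ℂ) * φ.character g) :
    0 ≤ ∑ φ ∈ S, (φ.mult (τ.tprod τ) : ℝ) ^ 2 *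
          (8 - 6 / a * (1 - (φ.character α).re / (φ.dim : ℝ))) ∧
    ∀ x₀ : ℝ, |μ.real {g : G | (τ.character g).re ≤ x₀} - gaussCDF x₀| ≤
      √(∑ φ ∈ S, if φ = IrrepClass.triv G then 0 else (φ.mult (τ.tprod τ) : ℝ) ^ 2 *
            (2 - 1 / a * (1 - (φ.character α).re / (φ.dim : ℝ))) ^ 2) +
        (1 / Real.pi * ∑ φ ∈ S, (φ.mult (τ.tprod τ) : ℝ) ^ 2 *
            (8 - 6 / a * (1 - (φ.character α).re / (φ.dim : ℝ)))) ^ (1 / 4 : ℝ) := by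
  let w : G → ℝ := fun g => (τ.character g).re
  let c : IrrepClass G → ℝ := fun φ => (φ.character α).re / φ.dim
  let m : IrrepClass G → ℝ := fun φ => φ.mult (τ.tprod τ)
  have hw : Continuous w := Complex.continuous_re.comp hτ.continuous_character
  have hint {F : G → ℝ} (hF : Continuous F) : Integrable F μ :=
    hF.integrable_of_hasCompactSupport (HasCompactSupport.of_compactSpace _)
  have hintP {F : G × G → ℝ} (hF : Continuous F) : Integrable F (μ.prod μ) :=
    integrable_prod_of_continuous μ hF
  let w' : G × G → ℝ := fun p => w (p.2 * α * p.2⁻¹ * p.1)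
  have hw' : Continuous w' := hw.comp (by fun_prop)
  have hw'g (g : G) : Continuous fun h => w' (g, h) := hw'.comp (by fun_prop)
  have hmean (g : G) : ∫ h, w' (g, h) ∂μ = (1 - a) * w g := by
    rw [ha, sub_sub_cancel]
    exact integral_re_character_conj_mul μ hτ hirr hreal α g
  let q : G → ℝ := fun g => ∫ h, w' (g, h) ^ 2 ∂μ
  have hq (g : G) : (q g : ℂ) = ∑ φ ∈ S, ((m φ * c φ : ℝ) : ℂ) * φ.character g :=
    integral_re_character_sq_conj_mul μ hreal hα hS g
  have hw2 (g : G) : ((w g ^ 2 : ℝ) : ℂ) = ∑ φ ∈ S, (m φ : ℂ) * φ.character g := by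
    rw [Complex.ofReal_pow, ofReal_re_character hreal, sq, ← Pi.mul_apply τ.character,
      ← Representation.char_tensor, hS]
    simp only [m, Complex.ofReal_natCast]
  -- Constants are multiples of the trivial character, so they enter Parseval's identity through the
  -- trivial class.
  have hconst (r : ℝ) (g : G) : (((fun _ => r : G → ℝ) g : ℝ) : ℂ) =
      ∑ φ ∈ S, ((if φ = IrrepClass.triv G then r else 0 : ℝ) : ℂ) * φ.character g := by
    rw [Finset.sum_eq_single_of_mem _ hSt fun φ _ hφ => by simp [hφ]]
    simp [IrrepClass.character_triv]
  have hm1 : m (IrrepClass.triv G) = 1 := by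
    have h := IrrepClass.integral_mul_eq_sum μ (hconst 1) hw2
    simpa [hSt, w, integral_re_character_sq μ hτ hirr hreal] using h.symm
  have hc1 : c (IrrepClass.triv G) = 1 := by
    simp [c, IrrepClass.character_triv, IrrepClass.dim_triv]
  have hfub {F : G × G → ℝ} (hF : Continuous F) :
      ∫ p, F p ∂μ.prod μ = ∫ g, ∫ h, F (g, h) ∂μ ∂μ := integral_prod _ (hintP hF)
  let D : G → ℝ := fun g => ∫ h, (w' (g, h) - w g) ^ 2 ∂μ
  have hDq (g : G) : D g = q g - (1 - 2 * a) * w g ^ 2 := by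
    have e : ∀ h, (w' (g, h) - w g) ^ 2 = w' (g, h) ^ 2 - w' (g, h) * (2 * w g) + w g ^ 2 :=
      fun h => by ring
    simp only [D, e]
    rw [integral_add (hint (by fun_prop)) (integrable_const _),
      integral_sub (hint (by fun_prop)) (hint (by fun_prop)), integral_mul_const, hmean]
    simp only [integral_const, probReal_univ, one_smul, q]
    ring
  have hD (g : G) : (D g : ℂ) =
      ∑ φ ∈ S, ((m φ * (2 * a - (1 - c φ)) : ℝ) : ℂ) * φ.character g := by
    rw [hDq, Complex.ofReal_sub, Complex.ofReal_mul, hw2, hq, Finset.mul_sum,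
      ← Finset.sum_sub_distrib]
    refine Finset.sum_congr rfl fun φ _ => ?_
    push_cast
    ring
  have hDc : Continuous D := by
    have : D = fun g => (∑ φ ∈ S, ((m φ * (2 * a - (1 - c φ)) : ℝ) : ℂ) * φ.character g).re := by
      ext g
      rw [← hD, Complex.ofReal_re]
    rw [this]
    exact Complex.continuous_re.comp (continuous_finsetSum _ fun φ _ =>
      continuous_const.mul φ.continuous_character)
  have hexch {u : ℝ × ℝ → ℝ} (hu : Continuous u) :
      ∫ p, u (w p.1, w' p) ∂μ.prod μ = ∫ p, u (w' p, w p.1) ∂μ.prod μ :=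
    integral_conj_mul_exchange μ hα (F := fun p => u (w p.1, w p.2)) (by fun_prop)
  have hlin {u : ℝ → ℝ} (hu : Continuous u) :
      ∫ p, u (w p.1) * w' p ∂μ.prod μ = (1 - a) * ∫ p, u (w p.1) * w p.1 ∂μ.prod μ := by
    rw [hfub (by fun_prop), hfub (by fun_prop)]
    simp only [integral_const_mul, hmean, integral_const, probReal_univ, one_smul]
    rw [← integral_const_mul]
    refine integral_congr_ae (.of_forall fun g => ?_)
    simp only
    ring
  have hcond {u : ℝ → ℝ} (hu : Continuous u) :
      ∫ p, u (w p.1) * (w' p - w p.1) ^ 2 ∂μ.prod μ = ∫ p, u (w p.1) * D p.1 ∂μ.prod μ := by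
    rw [hfub (by fun_prop), hfub (by fun_prop)]
    simp only [integral_const_mul, integral_const, probReal_univ, one_smul, D]
  have hfst {F : G → ℝ} (hF : Continuous F) : ∫ p, F p.1 ∂μ.prod μ = ∫ g, F g ∂μ := by
    rw [hfub (by fun_prop)]
    simp
  have hE2 : ∫ p, (w' p - w p.1) ^ 2 ∂μ.prod μ = 2 * a := by
    have h1 := hcond (u := fun _ => 1) continuous_const
    have h2 := IrrepClass.integral_mul_eq_sum μ (hconst 1) hD
    simp only [one_mul] at h1 h2
    rw [h1, hfst hDc, h2]
    simp [hSt, hm1, hc1]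
  -- Stein's bound needs `a > 0`; the identity `2a = E(W' - W)²` excludes negative values.
  have hapos : 0 < a := by
    have : 0 ≤ ∫ p, (w' p - w p.1) ^ 2 ∂μ.prod μ := integral_nonneg fun p => sq_nonneg _
    rw [hE2] at this
    exact lt_of_le_of_ne (by linarith) ha0.symm
  have hM4 : ∫ p, w p.1 ^ 4 ∂μ.prod μ = ∑ φ ∈ S, m φ ^ 2 := by
    rw [hfst (F := fun g => w g ^ 4) (by fun_prop)]
    have h := IrrepClass.integral_mul_eq_sum μ hw2 hw2
    simp only [← sq, ← pow_mul] at h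
    exact h
  have hM22 : ∫ p, w p.1 ^ 2 * w' p ^ 2 ∂μ.prod μ = ∑ φ ∈ S, m φ ^ 2 * c φ := by
    rw [hfub (by fun_prop)]
    simp only [integral_const_mul]
    have h := IrrepClass.integral_mul_eq_sum μ hw2 hq
    simp only [← mul_assoc, ← sq] at h
    exact h
  have hM31 : ∫ p, w p.1 ^ 3 * w' p ∂μ.prod μ = (1 - a) * ∑ φ ∈ S, m φ ^ 2 := by
    rw [hlin (u := fun x => x ^ 3) (by fun_prop), ← hM4]
    simp only [← pow_succ]
  have hM13 : ∫ p, w' p ^ 3 * w p.1 ∂μ.prod μ = (1 - a) * ∑ φ ∈ S, m φ ^ 2 := by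
    rw [← hM31]
    exact (hexch (u := fun z => z.1 ^ 3 * z.2) (by fun_prop)).symm
  have hM04 : ∫ p, w' p ^ 4 ∂μ.prod μ = ∑ φ ∈ S, m φ ^ 2 := by
    rw [← hM4]
    exact (hexch (u := fun z => z.1 ^ 4) (by fun_prop)).symm
  -- After expansion, exchangeability reduces the moments to `E W⁴`, `E W³W'` and `E W²W'²`, which
  -- are `Σ m²`, `(1 - a) Σ m²` and `Σ m² c`.
  have hE4 : ∫ p, (w' p - w p.1) ^ 4 ∂μ.prod μ =
      a * ∑ φ ∈ S, m φ ^ 2 * (8 - 6 / a * (1 - c φ)) := by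
    have e : ∀ p : G × G, (w' p - w p.1) ^ 4 = w' p ^ 4 - 4 * (w' p ^ 3 * w p.1) +
        6 * (w p.1 ^ 2 * w' p ^ 2) - 4 * (w p.1 ^ 3 * w' p) + w p.1 ^ 4 := fun p => by ring
    simp only [e]
    rw [integral_add (hintP (by fun_prop)) (hintP (by fun_prop)),
      integral_sub (hintP (by fun_prop)) (hintP (by fun_prop)),
      integral_add (hintP (by fun_prop)) (hintP (by fun_prop)),
      integral_sub (hintP (by fun_prop)) (hintP (by fun_prop)), integral_const_mul,
      integral_const_mul, integral_const_mul, hM4, hM22, hM31, hM13, hM04]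
    have e2 : ∀ φ, a * (m φ ^ 2 * (8 - 6 / a * (1 - c φ))) =
        (8 * a - 6) * m φ ^ 2 + 6 * (m φ ^ 2 * c φ) := fun φ => by
      field_simp
      ring
    rw [Finset.mul_sum S _ a, Finset.sum_congr rfl fun φ _ => e2 φ, Finset.sum_add_distrib,
      ← Finset.mul_sum, ← Finset.mul_sum]
    ring
  have hSum0 : 0 ≤ ∑ φ ∈ S, m φ ^ 2 * (8 - 6 / a * (1 - c φ)) := by
    have : 0 ≤ ∫ p, (w' p - w p.1) ^ 4 ∂μ.prod μ := integral_nonneg fun p => by positivity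
    rw [hE4] at this
    exact nonneg_of_mul_nonneg_right this hapos
  refine ⟨hSum0, fun x₀ => ?_⟩
  have hstein := abs_measureReal_sub_gaussCDF_le (P := μ.prod μ) (W := fun p => w p.1) (W' := w')
    (D := fun p => D p.1) hapos (fun u hu => hintP (by fun_prop)) (fun u hu => hexch hu)
    (fun u hu => by
      simp only [mul_sub]
      rw [integral_sub (hintP (by fun_prop)) (hintP (by fun_prop)), hlin hu]
      ring) (hintP (by fun_prop)) (hintP (by fun_prop)) (fun u hu => hcond hu)
    (hw.measurable.comp measurable_fst) x₀
  have hprob : (μ.prod μ).real {p | w p.1 ≤ x₀} = μ.real {g | w g ≤ x₀} :=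
    (measurePreserving_fst (μ := μ) (ν := μ)).measureReal_preimage
      (measurableSet_le hw.measurable measurable_const).nullMeasurableSet
  rw [hprob] at hstein
  refine hstein.trans (add_le_add (Real.sqrt_le_sqrt (le_of_eq ?_)) ?_)
  · rw [hfst (F := fun g => (2 - D g / a) ^ 2) (by fun_prop)]
    -- At the trivial class `m = c = 1`, so the coefficient is `2 - 2a/a = 0`; hence the first sum
    -- omits that class.
    have h2D (g : G) : ((2 - D g / a : ℝ) : ℂ) = ∑ φ ∈ S,
        (((if φ = IrrepClass.triv G then 2 else 0) - m φ * (2 * a - (1 - c φ)) / a : ℝ) : ℂ) *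
          φ.character g := by
      simp only [Complex.ofReal_sub, sub_mul, Finset.sum_sub_distrib, Complex.ofReal_div, hD]
      congr 1
      · exact hconst 2 g
      · rw [Finset.sum_div]
        exact Finset.sum_congr rfl fun φ _ => by ring
    have h := IrrepClass.integral_mul_eq_sum μ h2D h2D
    simp only [← sq] at h
    rw [h]
    refine Finset.sum_congr rfl fun φ _ => ?_
    split_ifs with hφ
    · rw [hφ, hm1, hc1]
      field_simp
      ring
    · change _ = m φ ^ 2 * (2 - 1 / a * (1 - c φ)) ^ 2
      field_simp
      ring
  · set T := ∑ φ ∈ S, m φ ^ 2 * (8 - 6 / a * (1 - c φ)) with hT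
    change _ ≤ (1 / Real.pi * T) ^ (1 / 4 : ℝ)
    set E3 := ∫ p, |w' p - w p.1| ^ 3 ∂μ.prod μ with hE3
    have hE30 : 0 ≤ E3 := integral_nonneg fun p => by positivity
    -- Cauchy–Schwarz with `|W' - W|³ = |W' - W| · |W' - W|²`, bounding the third moment by the
    -- second and fourth.
    have hCS : E3 ^ 2 ≤ 2 * a * (a * T) := by
      rw [← hE2, ← hE4]
      have h := sq_integral_mul_le (P := μ.prod μ) (X := fun p => |w' p - w p.1|)
        (Y := fun p => |w' p - w p.1| ^ 2) (hintP (by fun_prop)) (hintP (by fun_prop))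
        (hintP (by fun_prop))
      simp only [sq_abs, ← pow_mul] at h
      convert h using 3
      ext p
      rw [← sq_abs (w' p - w p.1)]
      ring
    have hπ := Real.pi_pos
    have hy : √((√(2 * Real.pi))⁻¹ * (E3 / a)) ^ 4 ≤ 1 / Real.pi * T := by
      rw [show 4 = 2 * 2 by norm_num, pow_mul, Real.sq_sqrt (by positivity), mul_pow, inv_pow,
        Real.sq_sqrt (by positivity), div_pow]
      calc (2 * Real.pi)⁻¹ * (E3 ^ 2 / a ^ 2)
          ≤ (2 * Real.pi)⁻¹ * (2 * a * (a * T) / a ^ 2) := by gcongr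
        _ = 1 / Real.pi * T := by field_simp
    calc √((√(2 * Real.pi))⁻¹ * (E3 / a))
        = (√((√(2 * Real.pi))⁻¹ * (E3 / a)) ^ 4) ^ (1 / 4 : ℝ) := by
          rw [← Real.rpow_natCast, ← Real.rpow_mul (Real.sqrt_nonneg _)]
          norm_num
      _ ≤ _ := Real.rpow_le_rpow (by positivity) hy (by norm_num)

end Moments

end CompactLieCLT

end

/-! ### The theorem for compact Lie groups -/

open CompactLieCLT in
theorem theorem3
    {E H G V : Type*}
    -- `G` is a compact Lie group
    [NormedAddCommGroup E] [NormedSpace ℝ E] [FiniteDimensional ℝ E] [TopologicalSpace H]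
    (I : ModelWithCorners ℝ E H) [I.Boundaryless]
    [Group G] [TopologicalSpace G] [ChartedSpace H G] [LieGroup I ∞ G]
    [CompactSpace G] [T2Space G]
    -- `μ` is its normalized Haar measure
    [MeasurableSpace G] [BorelSpace G]
    (μ : Measure G) [μ.IsHaarMeasure] [IsProbabilityMeasure μ]
    -- `τ` is a nontrivial irreducible representation with real-valued character
    [AddCommGroup V] [Module ℂ V] [FiniteDimensional ℂ V]
    (τ : Representation ℂ G V) (hτ : IsContinuousRep τ) (hirr : τ.IsIrreducible)
    (hnontriv : ¬ τ.IsTrivial) (hreal : ∀ g : G, (τ.character g).im = 0)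
    -- `α ≠ 1` is conjugate to its inverse
    (α : G) (hα : α ≠ 1) (hconj : IsConj α α⁻¹)
    -- `a = 1 - χ^τ(α) / dim τ`, by which the bound divides
    (a : ℝ) (ha : a = 1 - (τ.character α).re / (Module.finrank ℂ V : ℝ)) (ha0 : a ≠ 0) :
    -- the quantities in the bound make sense: the `χ^φ(α)` are real, the sums are finite,
    -- and the fourth root is taken of a nonnegative number
    (∀ φ : IrrepClass G, (φ.character α).im = 0) ∧
    {φ : IrrepClass G | φ.mult (τ.tprod τ) ≠ 0}.Finite ∧
    0 ≤ ∑ᶠ φ : IrrepClass G, (φ.mult (τ.tprod τ) : ℝ) ^ 2 *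
          (8 - 6 / a * (1 - (φ.character α).re / (φ.dim : ℝ))) ∧
    -- the bound
    ∀ x₀ : ℝ,
      |μ.real {g : G | (τ.character g).re ≤ x₀} -
          1 / √(2 * Real.pi) * ∫ x in Iic x₀, Real.exp (-x ^ 2 / 2)| ≤
        √(∑ᶠ (φ : IrrepClass G) (_ : ¬ φ.IsTrivial), (φ.mult (τ.tprod τ) : ℝ) ^ 2 *
            (2 - 1 / a * (1 - (φ.character α).re / (φ.dim : ℝ))) ^ 2) +
        (1 / Real.pi * ∑ᶠ φ : IrrepClass G, (φ.mult (τ.tprod τ) : ℝ) ^ 2 *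
            (8 - 6 / a * (1 - (φ.character α).re / (φ.dim : ℝ)))) ^ (1 / 4 : ℝ) := by
  have : IsTopologicalGroup G := topologicalGroup_of_lieGroup I ∞
  have : SecondCountableTopology H := I.secondCountableTopology
  -- Second countability makes the Borel sets of `G × G` those of the product σ-algebra, so
  -- continuous functions of the pair are measurable.
  have : SecondCountableTopology G := ChartedSpace.secondCountable_of_sigmaCompact H G
  classical
  obtain ⟨S, hSsupp, hS⟩ := IrrepClass.exists_finset_character_eq μ (hτ.tprod hτ)
  -- Adding the trivial class is harmless: multiplicities outside `S` vanish.
  have hS' (g : G) : (τ.tprod τ).character g =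
      ∑ φ ∈ insert (IrrepClass.triv G) S, (φ.mult (τ.tprod τ) : ℂ) * φ.character g := by
    rw [hS, Finset.sum_subset (Finset.subset_insert _ _)]
    intro φ _ hφ
    rw [not_imp_comm.1 (hSsupp φ) hφ, Nat.cast_zero, zero_mul]
  obtain ⟨h0, hbound⟩ := clt_of_finset μ hτ hirr hreal hconj ha ha0
    (Finset.mem_insert_self _ _) hS'
  have hsupp {f : IrrepClass G → ℝ} :
      (Function.support fun φ => (φ.mult (τ.tprod τ) : ℝ) ^ 2 * f φ) ⊆
        ↑(insert (IrrepClass.triv G) S) := by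
    intro φ hφ
    refine Finset.mem_coe.2 (Finset.mem_insert_of_mem (hSsupp φ fun h => hφ ?_))
    simp [h]
  have hfin : ∑ᶠ φ : IrrepClass G, (φ.mult (τ.tprod τ) : ℝ) ^ 2 *
      (8 - 6 / a * (1 - (φ.character α).re / (φ.dim : ℝ))) = _ :=
    finsum_eq_sum_of_support_subset _ hsupp
  have hfin' : ∑ᶠ (φ : IrrepClass G) (_ : ¬ φ.IsTrivial), (φ.mult (τ.tprod τ) : ℝ) ^ 2 *
      (2 - 1 / a * (1 - (φ.character α).re / (φ.dim : ℝ))) ^ 2 =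
      ∑ φ ∈ insert (IrrepClass.triv G) S, if φ = IrrepClass.triv G then 0 else
        (φ.mult (τ.tprod τ) : ℝ) ^ 2 *
          (2 - 1 / a * (1 - (φ.character α).re / (φ.dim : ℝ))) ^ 2 := by
    simp only [finsum_eq_if, IrrepClass.isTrivial_iff μ, ite_not]
    refine finsum_eq_sum_of_support_subset _ fun φ hφ => hsupp
      (f := fun φ => (2 - 1 / a * (1 - (φ.character α).re / (φ.dim : ℝ))) ^ 2) fun h => hφ ?_
    simp only at h
    simp only [h, ite_self]
  rw [hfin, hfin']
  refine ⟨fun φ => φ.character_im_eq_zero μ hconj, S.finite_toSet.subset fun φ hφ => hSsupp φ hφ,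
    h0, fun x₀ => ?_⟩
  have hcdf : gaussCDF x₀ =
      1 / √(2 * Real.pi) * ∫ x in Iic x₀, Real.exp (-x ^ 2 / 2) := by
    simp only [gaussCDF, gaussDensity, integral_const_mul, one_div]
  rw [← hcdf]
  exact hbound x₀
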